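/- Let $1<p_0<q<\infty$, $p_1\in(1,\infty)$ and $q_0\in[1,\infty]$, and put $r=\frac{p_0q}{p_1(q-p_0)}$. For a measurable function $f$ on $(0,\infty)$ (with Lebesgue measure) let $f^*(t)=\inf\{\lambda\ge 0:|\{|f|>\lambda\}|\le t\}$ be its non-increasing rearrangement, let $$\|f\|_{r,s}=\Bigl(\int_0^\infty \bigl(t^{\frac1r-\frac1s}f^*(t)\bigr)^{s}\,dt\Bigr)^{1/s}\quad(s<\infty),\qquad \|f\|_{r,\infty}=\sup_{t>0}t^{\frac1r}f^*(t)$$ be the Lorentz functional ($1/\infty=0$), and let $L^{r,s}=L^{r,s}(0,\infty)$ be the set of all measurable $f:(0,\infty)\to[-\infty,\infty]$ with $\|f\|_{r,s}<\infty$. Call $(r,s)$ normable if $r=s=1$, or $1<r<\infty$ and $1\le s\le\infty$, or $r=s=\infty$ (these are the pairs for which $L^{r,s}$ is equivalent to a rearrangement-invariant Banach function space). For $f\ge0$ measurable on $(0,\infty)$ and $t>0$ let $$R_{q_0}f(t)=t^{-\frac1{p_1}}\Bigl(\int_0^{t^r}s^{\frac{q_0}{p_0}-1}f^*(s)^{q_0}\,ds\Bigr)^{\frac1{q_0}},$$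 where the second factor means $\sup_{0<s\le t^r}s^{1/p_0}f^*(s)$ if $q_0=\infty$. (a) Let $(r_1,s_1)$ and $(r_2,s_2)$ be normable. Then $R_{q_0}$ is bounded from $L^{r_1,s_1}$ to $L^{r_2,s_2}$, that is, there is a constant $C<\infty$ with $\|R_{q_0}f\|_{r_2,s_2}\le C\|f\|_{r_1,s_1}$ for all $0\le f\in L^{r_1,s_1}$, if and only if $$\frac1q+\frac1{r\,r_2}=\frac1{r_1}$$ and one of the following conditions holds: (i) $r_1=p_0$, $s_1\le q_0$ and $s_2=\infty$; (ii) $r_1\in(p_0,q]$ and $1\le s_1\le s_2\le\infty$. (b) Let $1\le p<\rho\le\infty$ and let $(\rho,s)$ be normable. Let $(L^{\rho,s})^{\langle p,q_0\rangle}$ be the set of all measurable $f:(0,\infty)\to[-\infty,\infty]$ with finite $$\|f\|_{(L^{\rho,s})^{\langle p,q_0\rangle}}=\Bigl\|\,t^{-\frac1p}\Bigl(\int_0^t \tau^{\frac{q_0}{p}-1}f^*(\tau)^{q_0}\,d\tau\Bigr)^{\frac1{q_0}}\Bigr\|_{\rho,s}$$ (with $\sup_{0<\tau\le t}\tau^{1/p}f^*(\tau)$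 in place of the second factor if $q_0=\infty$). Then $(L^{\rho,s})^{\langle p,q_0\rangle}=L^{\rho,s}$, with equivalent functionals. -/

import Mathlib

open MeasureTheory Set
open scoped ENNReal NNReal

noncomputable section

namespace LorentzCalderon

/-- Lebesgue measure on the half-line `(0, ∞)`. Functions on `(0, ∞)` are represented by functions
on `ℝ`, whose values outside `(0, ∞)` play no role. -/
def halfLine : Measure ℝ := volume.restrict (Ioi (0 : ℝ))

/-- The non-increasing rearrangement `f^*(t) = inf {l ≥ 0 : |{f > l}| ≤ t}` of a non-negative
function on `(0, ∞)`. -/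
def rearrangement (f : ℝ → ℝ≥0∞) (t : ℝ) : ℝ≥0∞ :=
  sInf {l : ℝ≥0∞ | halfLine {x | l < f x} ≤ ENNReal.ofReal t}

/-- The Lorentz functional `‖t^{1/r - 1/s} f^*(t)‖_{L^s(0,∞)}` (with `1/∞ = 0`). -/
def lorentzNorm (r s : ℝ≥0∞) (f : ℝ → ℝ≥0∞) : ℝ≥0∞ :=
  if s = ∞ then
    ⨆ t ∈ Ioi (0 : ℝ), ENNReal.ofReal (t ^ r⁻¹.toReal) * rearrangement f t
  else
    (∫⁻ t in Ioi (0 : ℝ),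
      (ENNReal.ofReal (t ^ (r⁻¹.toReal - s⁻¹.toReal)) * rearrangement f t) ^ s.toReal)
        ^ (1 / s.toReal)

/-- The parameters for which `L^{r,s}` is normable, that is, equivalent to a
rearrangement-invariant Banach function space. -/
def NormableParams (r s : ℝ≥0∞) : Prop :=
  (r = 1 ∧ s = 1) ∨ (1 < r ∧ r < ∞ ∧ 1 ≤ s) ∨ (r = ∞ ∧ s = ∞)

/-- The quantity `(∫_0^t s^{q₀/p - 1} f^*(s)^{q₀} ds)^{1/q₀}`, read as
`sup_{0 < s ≤ t} s^{1/p} f^*(s)` when `q₀ = ∞`. -/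
def localLorentz (p : ℝ) (q₀ : ℝ≥0∞) (f : ℝ → ℝ≥0∞) (t : ℝ) : ℝ≥0∞ :=
  if q₀ = ∞ then
    ⨆ s ∈ Ioc (0 : ℝ) t, ENNReal.ofReal (s ^ (1 / p)) * rearrangement f s
  else
    (∫⁻ s in Ioc (0 : ℝ) t,
      ENNReal.ofReal (s ^ (q₀.toReal / p - 1)) * rearrangement f s ^ q₀.toReal)
        ^ (1 / q₀.toReal)

/-- The exponent `r = p₀ q / (p₁ (q - p₀))`. -/
def rExp (p₀ p₁ q : ℝ) : ℝ := p₀ * q / (p₁ * (q - p₀))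

/-- The operator `R_{q₀} f(t) = t^{-1/p₁} (∫_0^{t^r} s^{q₀/p₀ - 1} f^*(s)^{q₀} ds)^{1/q₀}`. -/
def opR (p₀ p₁ q : ℝ) (q₀ : ℝ≥0∞) (f : ℝ → ℝ≥0∞) (t : ℝ) : ℝ≥0∞ :=
  ENNReal.ofReal (t ^ (-(1 / p₁))) * localLorentz p₀ q₀ f (t ^ rExp p₀ p₁ q)

/-- The functional of `X^{⟨p,q₀⟩}`, where `ρ` is the functional of `X`. -/
def angleNorm (ρ : (ℝ → ℝ≥0∞) → ℝ≥0∞) (p : ℝ) (q₀ : ℝ≥0∞) (f : ℝ → ℝ≥0∞) : ℝ≥0∞ :=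
  ρ fun t => ENNReal.ofReal (t ^ (-(1 / p))) * localLorentz p q₀ f t

/-- The space of all measurable `f : (0, ∞) → [-∞, ∞]` with `ρ(|f|) < ∞`. -/
def space (ρ : (ℝ → ℝ≥0∞) → ℝ≥0∞) : Set (ℝ → EReal) :=
  {f | AEMeasurable f halfLine ∧ ρ (fun t => (f t).abs) < ∞}

/-- Boundedness of an operator on non-negative measurable functions on `(0, ∞)`, from the space
given by `ρ₁` to the space given by `ρ₂`. -/
def IsBoundedOp (T : (ℝ → ℝ≥0∞) → ℝ → ℝ≥0∞) (ρ₁ ρ₂ : (ℝ → ℝ≥0∞) → ℝ≥0∞) : Prop :=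
  ∃ C : ℝ≥0, ∀ f : ℝ → ℝ≥0∞, AEMeasurable f halfLine → ρ₁ f < ∞ → ρ₂ (T f) ≤ C * ρ₁ f

/-- Equivalence of two functionals on the non-negative measurable functions on `(0, ∞)`. -/
def NormEquiv (ρ₁ ρ₂ : (ℝ → ℝ≥0∞) → ℝ≥0∞) : Prop :=
  ∃ C : ℝ≥0, 0 < C ∧ ∀ f : ℝ → ℝ≥0∞, AEMeasurable f halfLine →
    ρ₁ f ≤ C * ρ₂ f ∧ ρ₂ f ≤ C * ρ₁ f

end LorentzCalderon

end

open LorentzCalderon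

noncomputable section

namespace LorentzCalderon

/-! With respect to `dt / t`, the functional of `L^{r,s}` is the `L^s` norm of `t^{1/r} f^*(t)`, and
`R_{q₀}` is `t^{-α} L(t^κ)` with `α = 1/p₁`, `κ = r`, where `L(u)` is the `L^{q₀}(ds/s)` norm of
`s^{1/p₀} f^*(s)` over `(0, u]`. Write `a = 1/r₁`, `b = 1/r₂`. Since `κ/p₀ - 1/p₁ = κ/q`, the
relation between the exponents becomes `κ(1/p₀ - a) = α - b`.

Sufficiency. For `a < 1/p₀`, monotonicity of `f^*` gives embeddings in the second exponent
(`mellinNorm_embedding`), which reduce matters to `q₀ = 1` and `s₁ = s₂`. If `s₂ < ∞`,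
`hardy_inequality` then applies, but to the image itself, which need not be monotone. Since `L`
increases, the image lies below a decreasing tail integral of itself (`hardyOp_le_tail`), and
Tonelli shows that rearranging costs only a constant. If `s₂ = ∞`, the image lies below a multiple
of `t^{-b}`. At `a = 1/p₀`, `L` is bounded by the norm of `f`, so the image is `O(t^{-α})`.

Necessity. Indicators of `(0, X]` with varying `X` force the scaling relation. The image of one
fixed indicator decays no faster than `t^{-α}`, so `b ≤ α`, with `s₂ = ∞` in case of equality; hence
`a ≤ 1/p₀`. Also `b ≥ 0` gives `a ≥ 1/q`. The power `s^{-a}`, truncated to logarithmic length `M`,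
has norm of order at most `M^{1/s₁}`, whereas its image has norm at least of order `M^{1/q₀}` at the
endpoint and `M^{1/s₂}` in general. Letting `M → ∞` gives `s₁ ≤ q₀` and `s₁ ≤ s₂` respectively.

Part (b) is the case `κ = 1`, `α = 1/p`, `a = b` of the upper bound, together with the pointwise
domination of `f^*` by a multiple of its average (`mellinNorm_le_hardyOp`). -/

/-! ### The measure `dt / t` and integrals of powers. -/

/-- The measure `dt / t` on `(0, ∞)`. -/
def mulHaar : Measure ℝ := (volume.restrict (Ioi (0 : ℝ))).withDensity fun t => ENNReal.ofReal t⁻¹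

instance : SFinite mulHaar := by unfold mulHaar; infer_instance

instance : NullSingletonClass mulHaar :=
  ⟨fun x => withDensity_absolutelyContinuous _ _ (measure_singleton x)⟩

theorem setLIntegral_mulHaar {E : Set ℝ} (hE : MeasurableSet E) (hE0 : E ⊆ Ioi 0)
    (h : ℝ → ℝ≥0∞) :
    ∫⁻ t in E, h t ∂mulHaar = ∫⁻ t in E, ENNReal.ofReal t⁻¹ * h t := by
  unfold mulHaar
  rw [setLIntegral_withDensity_eq_setLIntegral_mul_non_measurable _ (by fun_prop) _ hE
    (by simp), Measure.restrict_restrict hE, inter_eq_left.2 hE0]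
  rfl

theorem setLIntegral_Ioi_zero_mulHaar (h : ℝ → ℝ≥0∞) :
    ∫⁻ t in Ioi 0, h t ∂mulHaar = ∫⁻ t, h t ∂mulHaar := by
  unfold mulHaar
  rw [restrict_withDensity measurableSet_Ioi, Measure.restrict_restrict measurableSet_Ioi,
    inter_self]

theorem setLIntegral_congr_of_subset {E : Set ℝ} (hE : MeasurableSet E) (hE0 : E ⊆ Ioi 0)
    {μ : Measure ℝ} {g h : ℝ → ℝ≥0∞} (H : ∀ t, 0 < t → g t = h t) :
    ∫⁻ t in E, g t ∂μ = ∫⁻ t in E, h t ∂μ :=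
  setLIntegral_congr_fun hE fun t ht => H t (hE0 ht)

theorem setLIntegral_Ioc_rpow_mulHaar {a x : ℝ} (ha : 0 < a) (hx : 0 < x) :
    ∫⁻ t in Ioc 0 x, ENNReal.ofReal (t ^ a) ∂mulHaar = ENNReal.ofReal (x ^ a / a) := by
  rw [setLIntegral_mulHaar measurableSet_Ioc Ioc_subset_Ioi_self]
  have h1 : ∫⁻ t in Ioc 0 x, ENNReal.ofReal t⁻¹ * ENNReal.ofReal (t ^ a) =
      ∫⁻ t in Ioc 0 x, ENNReal.ofReal (t ^ (a - 1)) := by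
    refine setLIntegral_congr_of_subset measurableSet_Ioc Ioc_subset_Ioi_self fun t ht => ?_
    rw [← ENNReal.ofReal_mul (by positivity), Real.rpow_sub_one ht.ne', div_eq_inv_mul]
  have h2 : IntervalIntegrable (fun t : ℝ => t ^ (a - 1)) volume 0 x :=
    intervalIntegral.intervalIntegrable_rpow' (by linarith)
  rw [h1, ← ofReal_integral_eq_lintegral_ofReal
    ((intervalIntegrable_iff_integrableOn_Ioc_of_le hx.le).1 h2),
    ← intervalIntegral.integral_of_le hx.le, integral_rpow (Or.inl (by linarith))]
  · simp [Real.zero_rpow ha.ne']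
  · exact (ae_restrict_mem measurableSet_Ioc).mono fun t ht => Real.rpow_nonneg ht.1.le _

theorem setLIntegral_Ioi_rpow_mulHaar {a x : ℝ} (ha : 0 < a) (hx : 0 < x) :
    ∫⁻ t in Ioi x, ENNReal.ofReal (t ^ (-a)) ∂mulHaar = ENNReal.ofReal (x ^ (-a) / a) := by
  have hsub : Ioi x ⊆ Ioi 0 := Ioi_subset_Ioi hx.le
  rw [setLIntegral_mulHaar measurableSet_Ioi hsub]
  have h1 : ∫⁻ t in Ioi x, ENNReal.ofReal t⁻¹ * ENNReal.ofReal (t ^ (-a)) =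
      ∫⁻ t in Ioi x, ENNReal.ofReal (t ^ (-a - 1)) := by
    refine setLIntegral_congr_of_subset measurableSet_Ioi hsub fun t ht => ?_
    rw [← ENNReal.ofReal_mul (by positivity), Real.rpow_sub_one ht.ne', div_eq_inv_mul]
  rw [h1, ← ofReal_integral_eq_lintegral_ofReal
    (integrableOn_Ioi_rpow_of_lt (by linarith) hx), integral_Ioi_rpow_of_lt (by linarith) hx]
  · simp [div_neg, neg_div]
  · exact (ae_restrict_mem measurableSet_Ioi).mono fun t ht => Real.rpow_nonneg (hx.trans ht).le _

theorem mulHaar_Ioc {x y : ℝ} (hx : 0 < x) (hxy : x ≤ y) :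
    mulHaar (Ioc x y) = ENNReal.ofReal (Real.log (y / x)) := by
  have hsub : Ioc x y ⊆ Ioi 0 := fun t ht => hx.trans ht.1
  rw [← setLIntegral_one, setLIntegral_mulHaar measurableSet_Ioc hsub]
  simp only [mul_one]
  have h2 : IntervalIntegrable (fun t : ℝ => t⁻¹) volume x y :=
    intervalIntegral.intervalIntegrable_inv (fun t ht => by
      rw [uIcc_of_le hxy] at ht; exact (hx.trans_le ht.1).ne') continuousOn_id
  rw [← ofReal_integral_eq_lintegral_ofReal
    ((intervalIntegrable_iff_integrableOn_Ioc_of_le hxy).1 h2),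
    ← intervalIntegral.integral_of_le hxy, integral_inv_of_pos hx (hx.trans_le hxy)]
  exact (ae_restrict_mem measurableSet_Ioc).mono fun t ht => inv_nonneg.2 (hsub ht).le

/-- Tonelli's theorem for a product of functions of one variable on a measurable region. -/
theorem lintegral_mul_setLIntegral_swap {μ ν : Measure ℝ} [SFinite μ] [SFinite ν]
    {A B : ℝ → ℝ≥0∞} (hA : Measurable A) (hB : Measurable B) {E : Set (ℝ × ℝ)}
    (hE : MeasurableSet E) :
    ∫⁻ x, A x * ∫⁻ y in {y | (x, y) ∈ E}, B y ∂ν ∂μ =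
      ∫⁻ y, B y * ∫⁻ x in {x | (x, y) ∈ E}, A x ∂μ ∂ν := by
  have hm : Measurable (E.indicator fun z : ℝ × ℝ => A z.1 * B z.2) :=
    Measurable.indicator (by fun_prop) hE
  have h := lintegral_lintegral_swap (μ := μ) (ν := ν)
    (f := fun x y => E.indicator (fun z : ℝ × ℝ => A z.1 * B z.2) (x, y)) hm.aemeasurable
  convert h using 2
  · ext x
    have hx : MeasurableSet {y | (x, y) ∈ E} := measurable_prodMk_left hE
    rw [← lintegral_const_mul _ hB, ← lintegral_indicator hx]
    rfl
  · ext y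
    have hy : MeasurableSet {x | (x, y) ∈ E} := measurable_prodMk_right hE
    rw [← lintegral_const_mul _ hA, ← lintegral_indicator hy]
    simp only [indicator, mul_comm (B y)]
    rfl

/-! ### Non-increasing rearrangements. -/

theorem rearrangement_antitone (f : ℝ → ℝ≥0∞) : Antitone (rearrangement f) := fun _ _ h =>
  sInf_le_sInf fun _ hl => le_trans hl (ENNReal.ofReal_le_ofReal h)

theorem measurable_rearrangement (f : ℝ → ℝ≥0∞) : Measurable (rearrangement f) :=
  (rearrangement_antitone f).measurable

theorem le_rearrangement {f : ℝ → ℝ≥0∞} {l : ℝ≥0∞} {t : ℝ} {E : Set ℝ}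
    (hE : ∀ x ∈ E, l ≤ f x) (ht : ENNReal.ofReal t < halfLine E) : l ≤ rearrangement f t := by
  refine le_sInf fun m hm => ?_
  by_contra! hlt
  exact absurd (ht.trans_le (measure_mono fun x hx => hlt.trans_le (hE x hx))) (not_lt.2 hm)

theorem halfLine_Ioc {x y : ℝ} (hx : 0 ≤ x) : halfLine (Ioc x y) = ENNReal.ofReal (y - x) := by
  rw [halfLine, Measure.restrict_apply measurableSet_Ioc,
    inter_eq_left.2 (show Ioc x y ⊆ Ioi 0 from fun t ht => hx.trans_lt ht.1),
    Real.volume_Ioc]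

theorem le_rearrangement_of_Ioc {f : ℝ → ℝ≥0∞} {l : ℝ≥0∞} {t x y : ℝ} (hx : 0 ≤ x)
    (hxy : x < y) (ht : t < y - x) (H : ∀ z ∈ Ioc x y, l ≤ f z) : l ≤ rearrangement f t :=
  le_rearrangement H (by
    rw [halfLine_Ioc hx]; exact (ENNReal.ofReal_lt_ofReal_iff (by linarith)).2 ht)

/-- Where `f` exceeds `g t` the argument is at most `t`, so that set has measure at most `t`. Any
decreasing majorant thus bounds the rearrangement, which is how images of the operator are estimated
from above. -/
theorem rearrangement_le_of_antitoneOn {f g : ℝ → ℝ≥0∞} (hg : AntitoneOn g (Ioi 0))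
    (hfg : ∀ t, 0 < t → f t ≤ g t) {t : ℝ} (ht : 0 < t) : rearrangement f t ≤ g t := by
  refine sInf_le ?_
  rw [mem_ofPred_eq, halfLine, Measure.restrict_apply' measurableSet_Ioi]
  calc volume ({x | g t < f x} ∩ Ioi 0) ≤ volume (Ioc 0 t) := by
        refine measure_mono fun x hx => ⟨hx.2, ?_⟩
        by_contra! h
        exact absurd (hx.1.trans_le ((hfg x hx.2).trans (hg ht hx.2 h.le))) (lt_irrefl _)
    _ = ENNReal.ofReal t := by simp

/-- The set `{f > m}` has measure strictly above `t`, which leaves room for some `u > t`. The strict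
gap is what `le_rearrangement` asks for. -/
theorem exists_lt_le_rearrangement {f : ℝ → ℝ≥0∞} {m : ℝ≥0∞} {t : ℝ} (ht : 0 < t)
    (hm : m < rearrangement f t) : ∃ u, t < u ∧ m ≤ rearrangement f u := by
  have h : ENNReal.ofReal t < halfLine {x | m < f x} := by
    by_contra! h
    exact absurd (hm.trans_le (sInf_le h)) (lt_irrefl _)
  obtain ⟨u, hu0, htu, hu⟩ := ENNReal.lt_iff_exists_real_btwn.1 h
  exact ⟨u, (ENNReal.ofReal_lt_ofReal_iff_of_nonneg ht.le).1 htu,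
    le_rearrangement (fun x hx => le_of_lt hx) hu⟩

/-- No monotonicity of `g` is assumed: if `f^*(t) > m`, then `g ≥ m / c` on an interval `(0, u]`
with `u > t`. -/
theorem rearrangement_le_mul_rearrangement {f g : ℝ → ℝ≥0∞} {c : ℝ≥0∞} (hc0 : c ≠ 0)
    (hc : c ≠ ∞) (h : ∀ t, 0 < t → rearrangement f t ≤ c * g t) {t : ℝ} (ht : 0 < t) :
    rearrangement f t ≤ c * rearrangement g t := by
  refine le_of_forall_lt_imp_le_of_dense fun m hm => ?_
  obtain ⟨u, htu, hu⟩ := exists_lt_le_rearrangement ht hm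
  have h1 : m / c ≤ rearrangement g t :=
    le_rearrangement_of_Ioc le_rfl (ht.trans htu) (by simpa using htu) fun z hz =>
      ENNReal.div_le_of_le_mul' ((hu.trans (rearrangement_antitone f hz.2)).trans (h z hz.1))
  calc m = c * (m / c) := (ENNReal.mul_div_cancel hc0 hc).symm
    _ ≤ _ := by gcongr

/-! ### Lorentz functionals as `L^s(dt / t)` norms, and their embeddings. -/

/-- The `L^s(dt / t)` functional over a set `E`, with the supremum over `E` when `s = ∞`. -/
def mellinNorm (s : ℝ≥0∞) (E : Set ℝ) (h : ℝ → ℝ≥0∞) : ℝ≥0∞ :=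
  if s = ∞ then ⨆ t ∈ E, h t else (∫⁻ t in E, h t ^ s.toReal ∂mulHaar) ^ (1 / s.toReal)

/-- The function `t^a f^*(t)`. -/
def weightedRearrangement (a : ℝ) (f : ℝ → ℝ≥0∞) (t : ℝ) : ℝ≥0∞ :=
  ENNReal.ofReal (t ^ a) * rearrangement f t

theorem measurable_weightedRearrangement (a : ℝ) (f : ℝ → ℝ≥0∞) :
    Measurable (weightedRearrangement a f) := by
  have := measurable_rearrangement f
  unfold weightedRearrangement
  fun_prop

theorem toReal_pos_of_one_le {s : ℝ≥0∞} (hs : 1 ≤ s) (hs' : s ≠ ∞) : 0 < s.toReal :=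
  ENNReal.toReal_pos (zero_lt_one.trans_le hs).ne' hs'

theorem ofReal_rpow_rpow {t : ℝ} (ht : 0 < t) (a s : ℝ) :
    ENNReal.ofReal (t ^ a) ^ s = ENNReal.ofReal (t ^ (a * s)) := by
  rw [ENNReal.ofReal_rpow_of_pos (Real.rpow_pos_of_pos ht a), Real.rpow_mul ht.le]

theorem ofReal_rpow_mul {t : ℝ} (ht : 0 < t) (a b : ℝ) :
    ENNReal.ofReal (t ^ a) * ENNReal.ofReal (t ^ b) = ENNReal.ofReal (t ^ (a + b)) := by
  rw [← ENNReal.ofReal_mul (Real.rpow_nonneg ht.le _), Real.rpow_add ht]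

theorem lorentzNorm_eq_mellinNorm (r s : ℝ≥0∞) (hs : 1 ≤ s) (f : ℝ → ℝ≥0∞) :
    lorentzNorm r s f = mellinNorm s (Ioi 0) (weightedRearrangement r⁻¹.toReal f) := by
  unfold lorentzNorm mellinNorm weightedRearrangement
  split_ifs with h
  · rfl
  have hs0 := toReal_pos_of_one_le hs h
  rw [setLIntegral_mulHaar measurableSet_Ioi subset_rfl]
  congr 1
  refine setLIntegral_congr_of_subset measurableSet_Ioi subset_rfl fun t ht => ?_
  rw [ENNReal.mul_rpow_of_nonneg _ _ hs0.le, ENNReal.mul_rpow_of_nonneg _ _ hs0.le,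
    ofReal_rpow_rpow ht, ofReal_rpow_rpow ht, ← mul_assoc, ← Real.rpow_neg_one,
    ofReal_rpow_mul ht, ENNReal.toReal_inv s]
  congr 4
  field_simp
  ring

theorem localLorentz_eq_mellinNorm (p : ℝ) (q₀ : ℝ≥0∞) (hq₀ : 1 ≤ q₀) (f : ℝ → ℝ≥0∞) (u : ℝ) :
    localLorentz p q₀ f u = mellinNorm q₀ (Ioc 0 u) (weightedRearrangement (1 / p) f) := by
  unfold localLorentz mellinNorm weightedRearrangement
  split_ifs with h
  · rfl
  have hs0 := toReal_pos_of_one_le hq₀ h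
  rw [setLIntegral_mulHaar measurableSet_Ioc Ioc_subset_Ioi_self]
  congr 1
  refine setLIntegral_congr_of_subset measurableSet_Ioc Ioc_subset_Ioi_self fun t ht => ?_
  rw [ENNReal.mul_rpow_of_nonneg _ _ hs0.le, ofReal_rpow_rpow ht, ← mul_assoc,
    ← Real.rpow_neg_one, ofReal_rpow_mul ht]
  congr 3
  ring

theorem mellinNorm_mono_set (s : ℝ≥0∞) {E F : Set ℝ} (h : E ⊆ F) (g : ℝ → ℝ≥0∞) :
    mellinNorm s E g ≤ mellinNorm s F g := by
  unfold mellinNorm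
  split_ifs
  · exact biSup_mono fun t ht => h ht
  · gcongr

theorem mellinNorm_mono (s : ℝ≥0∞) {E : Set ℝ} (hE : MeasurableSet E) {g h : ℝ → ℝ≥0∞}
    (H : ∀ t ∈ E, g t ≤ h t) : mellinNorm s E g ≤ mellinNorm s E h := by
  unfold mellinNorm
  split_ifs
  · exact iSup₂_mono H
  · gcongr ?_ ^ _
    exact setLIntegral_mono' hE fun t ht => by gcongr; exact H t ht

theorem mellinNorm_const_mul (s : ℝ≥0∞) (hs : 1 ≤ s) (E : Set ℝ) {h : ℝ → ℝ≥0∞}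
    (hh : Measurable h) (c : ℝ≥0∞) :
    mellinNorm s E (fun t => c * h t) = c * mellinNorm s E h := by
  unfold mellinNorm
  split_ifs with hs'
  · simp only [ENNReal.mul_iSup]
  have hs0 := toReal_pos_of_one_le hs hs'
  simp only [ENNReal.mul_rpow_of_nonneg _ _ hs0.le]
  rw [lintegral_const_mul _ (by fun_prop), ENNReal.mul_rpow_of_nonneg _ _ (by positivity),
    ← ENNReal.rpow_mul, mul_one_div_cancel hs0.ne', ENNReal.rpow_one]

/-- The constant in the pointwise bound `t^a f^*(t) ≤ C ‖τ^a f^*(τ)‖_{L^s(dτ / τ)}`. -/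
def pointwiseConst (a : ℝ) (s : ℝ≥0∞) : ℝ≥0∞ :=
  if s = ∞ then 1 else ENNReal.ofReal (a * s.toReal) ^ (1 / s.toReal)

theorem pointwiseConst_ne_top (a : ℝ) (s : ℝ≥0∞) : pointwiseConst a s ≠ ∞ := by
  unfold pointwiseConst
  split_ifs
  · simp
  · exact ENNReal.rpow_ne_top_of_nonneg (by positivity) ENNReal.ofReal_ne_top

/-- On `(0, t]` the rearrangement is at least its value at `t`, and `τ^{as}` has `dτ/τ`-integral
`t^{as}/(as)` there. Positivity of `a` is asked only for finite `s`, because the normable pair `r =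
s = ∞` has `a = 0`. -/
theorem weightedRearrangement_le_mellinNorm {a : ℝ} {s : ℝ≥0∞} (hs : 1 ≤ s) (ha : s ≠ ∞ → 0 < a)
    (f : ℝ → ℝ≥0∞) {t : ℝ} (ht : 0 < t) {E : Set ℝ} (hE : Ioc 0 t ⊆ E) :
    weightedRearrangement a f t ≤
      pointwiseConst a s * mellinNorm s E (weightedRearrangement a f) := by
  refine le_trans ?_ (mul_le_mul_right (mellinNorm_mono_set s hE _) _)
  unfold pointwiseConst mellinNorm
  split_ifs with hs'
  · rw [one_mul]
    exact le_iSup₂_of_le t ⟨ht, le_rfl⟩ le_rfl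
  have hs0 := toReal_pos_of_one_le hs hs'
  have ha0 := ha hs'
  have has : 0 < a * s.toReal := mul_pos ha0 hs0
  rw [← ENNReal.mul_rpow_of_nonneg _ _ (by positivity), one_div, ENNReal.le_rpow_inv_iff hs0]
  unfold weightedRearrangement
  calc (ENNReal.ofReal (t ^ a) * rearrangement f t) ^ s.toReal
      = ENNReal.ofReal (a * s.toReal) *
        (ENNReal.ofReal (t ^ (a * s.toReal) / (a * s.toReal)) * rearrangement f t ^ s.toReal) := by
        rw [ENNReal.mul_rpow_of_nonneg _ _ hs0.le, ofReal_rpow_rpow ht, ← mul_assoc,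
          ← ENNReal.ofReal_mul has.le, mul_div_cancel₀ _ has.ne']
    _ = ENNReal.ofReal (a * s.toReal) *
        ∫⁻ τ in Ioc 0 t, ENNReal.ofReal (τ ^ (a * s.toReal)) * rearrangement f t ^ s.toReal
          ∂mulHaar := by
        rw [lintegral_mul_const _ (by fun_prop), setLIntegral_Ioc_rpow_mulHaar has ht]
    _ ≤ _ := by
        refine mul_le_mul_right (setLIntegral_mono' measurableSet_Ioc fun τ hτ => ?_) _
        rw [ENNReal.mul_rpow_of_nonneg _ _ hs0.le, ofReal_rpow_rpow hτ.1]
        have := rearrangement_antitone f hτ.2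
        gcongr

/-- The embedding of `L^{r,s₁}` into `L^{r,s₂}`, also in a form localised near zero. -/
theorem mellinNorm_embedding {a : ℝ} {s₁ s₂ : ℝ≥0∞} (hs₁ : 1 ≤ s₁) (hs : s₁ ≤ s₂)
    (ha : s₁ ≠ ∞ → 0 < a) : ∃ C : ℝ≥0∞, C ≠ ∞ ∧ ∀ (f : ℝ → ℝ≥0∞) (E : Set ℝ),
      MeasurableSet E → E ⊆ Ioi 0 → (∀ t ∈ E, Ioc 0 t ⊆ E) →
      mellinNorm s₂ E (weightedRearrangement a f) ≤
        C * mellinNorm s₁ E (weightedRearrangement a f) := by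
  by_cases h2 : s₂ = ∞
  · refine ⟨pointwiseConst a s₁, pointwiseConst_ne_top _ _, fun f E _ hE0 hE => ?_⟩
    rw [mellinNorm, if_pos h2]
    exact iSup₂_le fun t ht => weightedRearrangement_le_mellinNorm hs₁ ha f (hE0 ht) (hE t ht)
  have h1 : s₁ ≠ ∞ := ne_top_of_le_ne_top h2 hs
  have hs10 := toReal_pos_of_one_le hs₁ h1
  have hs20 := toReal_pos_of_one_le (hs₁.trans hs) h2
  have hle : s₁.toReal ≤ s₂.toReal := ENNReal.toReal_mono h2 hs
  set K := pointwiseConst a s₁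
  have hK : K ≠ ∞ := pointwiseConst_ne_top _ _
  refine ⟨(K ^ (s₂.toReal - s₁.toReal)) ^ (1 / s₂.toReal),
    ENNReal.rpow_ne_top_of_nonneg (by positivity)
      (ENNReal.rpow_ne_top_of_nonneg (by linarith) hK), fun f E hEm hE0 hE => ?_⟩
  set N := mellinNorm s₁ E (weightedRearrangement a f) with hN
  have hN1 : N ^ s₁.toReal = ∫⁻ t in E, weightedRearrangement a f t ^ s₁.toReal ∂mulHaar := by
    rw [hN, mellinNorm, if_neg h1, ← ENNReal.rpow_mul, one_div_mul_cancel hs10.ne',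
      ENNReal.rpow_one]
  have hm := measurable_weightedRearrangement a f
  rw [mellinNorm, if_neg h2]
  calc (∫⁻ t in E, weightedRearrangement a f t ^ s₂.toReal ∂mulHaar) ^ (1 / s₂.toReal)
      ≤ (∫⁻ t in E, (K * N) ^ (s₂.toReal - s₁.toReal) *
          weightedRearrangement a f t ^ s₁.toReal ∂mulHaar) ^ (1 / s₂.toReal) := by
        gcongr ?_ ^ _
        refine setLIntegral_mono' hEm fun t ht => ?_
        -- Interpolation between `L^{s₁}` and `L^∞`: the surplus power `s₂ - s₁` is bounded by the
        -- supremum, which the `s₁` norm controls.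
        calc weightedRearrangement a f t ^ s₂.toReal
            = weightedRearrangement a f t ^ (s₂.toReal - s₁.toReal) *
              weightedRearrangement a f t ^ s₁.toReal := by
              rw [← ENNReal.rpow_add_of_nonneg _ _ (by linarith) hs10.le, sub_add_cancel]
          _ ≤ _ := by
              gcongr ?_ * _
              exact ENNReal.rpow_le_rpow
                (weightedRearrangement_le_mellinNorm hs₁ ha f (hE0 ht) (hE t ht)) (by linarith)
    _ = (K ^ (s₂.toReal - s₁.toReal) * N ^ s₂.toReal) ^ (1 / s₂.toReal) := by
        rw [lintegral_const_mul _ (by fun_prop), ← hN1,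
          ENNReal.mul_rpow_of_nonneg K N (sub_nonneg.2 hle), mul_assoc,
          ← ENNReal.rpow_add_of_nonneg _ _ (by linarith) hs10.le, sub_add_cancel]
    _ = _ := by
        rw [ENNReal.mul_rpow_of_nonneg _ _ (by positivity), ← ENNReal.rpow_mul N,
          mul_one_div_cancel hs20.ne', ENNReal.rpow_one]

/-! ### The Hardy-type operator and Hardy's inequality. -/

/-- The operator `f ↦ t^{-α} (∫_0^{t^κ} s^{q₀/p - 1} f^*(s)^{q₀} ds)^{1/q₀}`. -/
def hardyOp (α κ p : ℝ) (q₀ : ℝ≥0∞) (f : ℝ → ℝ≥0∞) (t : ℝ) : ℝ≥0∞ :=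
  ENNReal.ofReal (t ^ (-α)) * localLorentz p q₀ f (t ^ κ)

theorem localLorentz_mono (p : ℝ) {q₀ : ℝ≥0∞} (hq₀ : 1 ≤ q₀) (f : ℝ → ℝ≥0∞) :
    Monotone (localLorentz p q₀ f) := fun u v h => by
  simp only [localLorentz_eq_mellinNorm p q₀ hq₀]
  exact mellinNorm_mono_set _ (Ioc_subset_Ioc_right h) _

theorem measurable_hardyOp (α κ p : ℝ) {q₀ : ℝ≥0∞} (hq₀ : 1 ≤ q₀) (f : ℝ → ℝ≥0∞) :
    Measurable (hardyOp α κ p q₀ f) := by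
  have := (localLorentz_mono p hq₀ f).measurable
  unfold hardyOp
  fun_prop

/-- The embedding from second exponent `1`, localised to `(0, u]`. It replaces every `q₀` by `q₀ =
1`, where the expression is linear in `f^*`. -/
theorem localLorentz_le_lintegral {p : ℝ} (hp : 0 < p) {q₀ : ℝ≥0∞} (hq₀ : 1 ≤ q₀) :
    ∃ C : ℝ≥0∞, C ≠ ∞ ∧ ∀ (f : ℝ → ℝ≥0∞) (u : ℝ), localLorentz p q₀ f u ≤
      C * ∫⁻ s in Ioc 0 u, weightedRearrangement (1 / p) f s ∂mulHaar := by
  obtain ⟨C, hC, h⟩ := mellinNorm_embedding (a := 1 / p) le_rfl hq₀ (fun _ => by positivity)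
  refine ⟨C, hC, fun f u => ?_⟩
  rw [localLorentz_eq_mellinNorm p q₀ hq₀]
  simpa [mellinNorm] using h f (Ioc 0 u) measurableSet_Ioc Ioc_subset_Ioi_self
    fun t ht => Ioc_subset_Ioc_right ht.2

theorem weightedRearrangement_add (a c : ℝ) (f : ℝ → ℝ≥0∞) {t : ℝ} (ht : 0 < t) :
    weightedRearrangement (c + a) f t = ENNReal.ofReal (t ^ c) * weightedRearrangement a f t := by
  rw [weightedRearrangement, weightedRearrangement, ← mul_assoc, ofReal_rpow_mul ht]

/-- Jensen's inequality for a weight of finite or infinite mass. -/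
theorem rpow_lintegral_mul_le {μ : Measure ℝ} {w H : ℝ → ℝ≥0∞} (hw : Measurable w)
    (hH : Measurable H) {σ : ℝ} (hσ : 1 ≤ σ) :
    (∫⁻ x, w x * H x ∂μ) ^ σ ≤ (∫⁻ x, w x ∂μ) ^ (σ - 1) * ∫⁻ x, w x * H x ^ σ ∂μ := by
  have hσ0 : 0 < σ := by linarith
  have hq : 0 ≤ 1 - 1 / σ := sub_nonneg.2 ((div_le_one hσ0).2 hσ)
  -- Hölder with exponents `1 - 1/σ` and `1/σ` for the pair `w`, `w H^σ`.
  have h := ENNReal.lintegral_mul_norm_pow_le (μ := μ) (f := w) (g := fun x => w x * H x ^ σ)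
    hw.aemeasurable (by fun_prop) hq (one_div_nonneg.2 hσ0.le) (sub_add_cancel _ _)
  have e : ∀ x, w x ^ (1 - 1 / σ) * (w x * H x ^ σ) ^ (1 / σ) = w x * H x := fun x => by
    rw [ENNReal.mul_rpow_of_nonneg _ _ (by positivity), ← ENNReal.rpow_mul,
      mul_one_div_cancel hσ0.ne', ENNReal.rpow_one, ← mul_assoc,
      ← ENNReal.rpow_add_of_nonneg _ _ hq (by positivity), sub_add_cancel, ENNReal.rpow_one]
  simp only [e] at h
  refine (ENNReal.rpow_le_rpow h hσ0.le).trans_eq ?_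
  rw [ENNReal.mul_rpow_of_nonneg _ _ hσ0.le, ← ENNReal.rpow_mul, ← ENNReal.rpow_mul,
    one_div_mul_cancel hσ0.ne', ENNReal.rpow_one, sub_mul, one_div_mul_cancel hσ0.ne', one_mul]

/-- Hardy's inequality for the measure `dt / t`. -/
theorem hardy_inequality {c κ σ : ℝ} (hc : 0 < c) (hκ : 0 < κ) (hσ : 1 ≤ σ) {H : ℝ → ℝ≥0∞}
    (hH : Measurable H) :
    ∫⁻ t in Ioi 0, (ENNReal.ofReal (t ^ (-(κ * c))) *
        ∫⁻ s in Ioc 0 (t ^ κ), ENNReal.ofReal (s ^ c) * H s ∂mulHaar) ^ σ ∂mulHaar ≤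
      ENNReal.ofReal ((1 / c) ^ (σ - 1) * (1 / (κ * c))) * ∫⁻ s in Ioi 0, H s ^ σ ∂mulHaar := by
  have hσ0 : 0 < σ := by linarith
  have hκc : 0 < κ * c := mul_pos hκ hc
  set E : Set (ℝ × ℝ) := {z | 0 < z.1 ∧ 0 < z.2 ∧ z.2 ≤ z.1 ^ κ}
  have hE : MeasurableSet E :=
    (measurableSet_lt measurable_const measurable_fst).inter
      ((measurableSet_lt measurable_const measurable_snd).inter
        (measurableSet_le measurable_snd (by fun_prop)))
  set A : ℝ → ℝ≥0∞ := fun t => ENNReal.ofReal (t ^ (-(κ * c)))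
  set B : ℝ → ℝ≥0∞ := fun s => ENNReal.ofReal (s ^ c) * H s ^ σ
  have hA : Measurable A := by fun_prop
  have hB : Measurable B := by fun_prop
  -- Jensen with the weight `s^c`, whose mass on `(0, t^κ]` is `t^{κc}/c`. This produces the factor
  -- `(1/c)^{σ-1}` and leaves one power `t^{-κc}` for Tonelli.
  have step : ∀ t ∈ Ioi (0 : ℝ), (ENNReal.ofReal (t ^ (-(κ * c))) *
        ∫⁻ s in Ioc 0 (t ^ κ), ENNReal.ofReal (s ^ c) * H s ∂mulHaar) ^ σ ≤
      ENNReal.ofReal ((1 / c) ^ (σ - 1)) * (A t * ∫⁻ s in {s | (t, s) ∈ E}, B s ∂mulHaar) := by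
    intro t (ht : 0 < t)
    have hset : {s | (t, s) ∈ E} = Ioc 0 (t ^ κ) := by
      ext s; exact ⟨fun h => h.2, fun h => ⟨ht, h⟩⟩
    rw [hset, ENNReal.mul_rpow_of_nonneg _ _ hσ0.le]
    calc _ ≤ ENNReal.ofReal (t ^ (-(κ * c))) ^ σ *
          ((∫⁻ s in Ioc 0 (t ^ κ), ENNReal.ofReal (s ^ c) ∂mulHaar) ^ (σ - 1) *
            ∫⁻ s in Ioc 0 (t ^ κ), B s ∂mulHaar) := by
          gcongr
          exact rpow_lintegral_mul_le (by fun_prop) hH hσ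
      _ = _ := by
          have htκ : 0 < t ^ κ := Real.rpow_pos_of_pos ht κ
          rw [setLIntegral_Ioc_rpow_mulHaar hc htκ, ← mul_assoc, ← mul_assoc]
          congr 1
          rw [ofReal_rpow_rpow ht, ENNReal.ofReal_rpow_of_pos (by positivity),
            ← ENNReal.ofReal_mul (by positivity), ← ENNReal.ofReal_mul (by positivity)]
          congr 1
          rw [div_eq_mul_one_div, Real.mul_rpow (by positivity) (by positivity),
            ← Real.rpow_mul ht.le, ← Real.rpow_mul ht.le, ← mul_assoc, ← Real.rpow_add ht,
            mul_comm]
          congr 2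
          ring
  refine (setLIntegral_mono' measurableSet_Ioi step).trans ?_
  rw [setLIntegral_Ioi_zero_mulHaar, lintegral_const_mul' _ _ ENNReal.ofReal_ne_top,
    lintegral_mul_setLIntegral_swap hA hB hE, ENNReal.ofReal_mul (by positivity), mul_assoc]
  gcongr
  rw [← setLIntegral_Ioi_zero_mulHaar,
    ← lintegral_const_mul' _ _ ENNReal.ofReal_ne_top]
  refine setLIntegral_mono' measurableSet_Ioi fun s (hs : 0 < s) => ?_
  -- The slice of the region at height `s` is `t ≥ s^{1/κ}`; the tail integral of `t^{-κc}` over it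
  -- is `s^{-c}/(κc)`, which cancels the weight `s^c`.
  have hset : {t | (t, s) ∈ E} = Ici (s ^ (1 / κ)) := by
    ext t
    constructor
    · rintro ⟨ht, -, h⟩
      have h : s ≤ t ^ κ := h
      rw [mem_Ici, one_div]
      exact (Real.rpow_inv_le_iff_of_pos hs.le (le_of_lt ht) hκ).2 h
    · intro h
      rw [mem_Ici, one_div] at h
      have ht : 0 < t := (Real.rpow_pos_of_pos hs _).trans_le h
      exact ⟨ht, hs, (Real.rpow_inv_le_iff_of_pos hs.le ht.le hκ).1 h⟩
  rw [hset, ← restrict_Ioi_eq_restrict_Ici, setLIntegral_Ioi_rpow_mulHaar hκc (by positivity),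
    mul_right_comm, ← ENNReal.ofReal_mul (by positivity)]
  gcongr
  refine le_of_eq ?_
  rw [← Real.rpow_mul hs.le, show 1 / κ * -(κ * c) = -c by field_simp, ← mul_div_assoc,
    ← Real.rpow_add hs, add_neg_cancel, Real.rpow_zero]

/-- The tail of `t^{-α} L(t^κ)`, integrated against `dt / t`, controls its values. -/
theorem hardyOp_le_tail {α κ p σ : ℝ} (hα : 0 < α) (hκ : 0 < κ) (hσ : 0 < σ) {q₀ : ℝ≥0∞}
    (hq₀ : 1 ≤ q₀) (f : ℝ → ℝ≥0∞) {t : ℝ} (ht : 0 < t) :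
    hardyOp α κ p q₀ f t ≤
      (ENNReal.ofReal (α * σ) * ∫⁻ v in Ioi t, hardyOp α κ p q₀ f v ^ σ ∂mulHaar) ^ (1 / σ) := by
  have hασ : 0 < α * σ := mul_pos hα hσ
  rw [one_div, ENNReal.le_rpow_inv_iff hσ, hardyOp, ENNReal.mul_rpow_of_nonneg _ _ hσ.le,
    ofReal_rpow_rpow ht]
  calc ENNReal.ofReal (t ^ (-α * σ)) * localLorentz p q₀ f (t ^ κ) ^ σ
      = ENNReal.ofReal (α * σ) * ∫⁻ v in Ioi t, ENNReal.ofReal (v ^ (-(α * σ))) *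
          localLorentz p q₀ f (t ^ κ) ^ σ ∂mulHaar := by
        rw [lintegral_mul_const _ (by fun_prop), setLIntegral_Ioi_rpow_mulHaar hασ ht, ← mul_assoc,
          ← ENNReal.ofReal_mul hασ.le, mul_div_cancel₀ _ hασ.ne', neg_mul]
    _ ≤ _ := by
        refine mul_le_mul_right (setLIntegral_mono' measurableSet_Ioi fun v hv => ?_) _
        have hv0 : 0 < v := ht.trans hv
        rw [hardyOp, ENNReal.mul_rpow_of_nonneg _ _ hσ.le, ofReal_rpow_rpow hv0, neg_mul]
        have := localLorentz_mono p hq₀ f (Real.rpow_le_rpow ht.le (le_of_lt hv) hκ.le)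
        gcongr

/-- The functional of `L^{1/b,σ}` of the operator is controlled without rearranging. -/
theorem lintegral_weightedRearrangement_hardyOp_le {α κ p σ b : ℝ} (hα : 0 < α) (hκ : 0 < κ)
    (hσ : 0 < σ) (hb : 0 < b) {q₀ : ℝ≥0∞} (hq₀ : 1 ≤ q₀) (f : ℝ → ℝ≥0∞) :
    ∫⁻ t in Ioi 0, weightedRearrangement b (hardyOp α κ p q₀ f) t ^ σ ∂mulHaar ≤
      ENNReal.ofReal (α / b) *
        ∫⁻ t in Ioi 0, (ENNReal.ofReal (t ^ b) * hardyOp α κ p q₀ f t) ^ σ ∂mulHaar := by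
  have hm := measurable_hardyOp α κ p hq₀ f
  have hbσ : 0 < b * σ := mul_pos hb hσ
  set T := hardyOp α κ p q₀ f
  -- A decreasing majorant of `T` by `hardyOp_le_tail`, hence a majorant of its rearrangement.
  set D : ℝ → ℝ≥0∞ := fun t =>
    (ENNReal.ofReal (α * σ) * ∫⁻ v in Ioi t, T v ^ σ ∂mulHaar) ^ (1 / σ) with hD
  have hDanti : AntitoneOn D (Ioi 0) := fun x _ y _ h => by
    simp only [hD]
    gcongr
  set E : Set (ℝ × ℝ) := {z | 0 < z.1 ∧ z.1 < z.2}
  have hE : MeasurableSet E :=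
    (measurableSet_lt measurable_const measurable_fst).inter
      (measurableSet_lt measurable_fst measurable_snd)
  set A : ℝ → ℝ≥0∞ := fun t => ENNReal.ofReal (t ^ (b * σ))
  have hA : Measurable A := by fun_prop
  have step : ∀ t ∈ Ioi (0 : ℝ), weightedRearrangement b T t ^ σ ≤
      ENNReal.ofReal (α * σ) * (A t * ∫⁻ v in {v | (t, v) ∈ E}, T v ^ σ ∂mulHaar) := by
    intro t (ht : 0 < t)
    have hset : {v | (t, v) ∈ E} = Ioi t := by
      ext v; exact ⟨fun h => h.2, fun h => ⟨ht, h⟩⟩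
    have h1 : rearrangement T t ≤ D t :=
      rearrangement_le_of_antitoneOn hDanti (fun t ht => hardyOp_le_tail hα hκ hσ hq₀ f ht) ht
    rw [hset, weightedRearrangement, ENNReal.mul_rpow_of_nonneg _ _ hσ.le, ofReal_rpow_rpow ht,
      mul_left_comm]
    gcongr
    refine (ENNReal.rpow_le_rpow h1 hσ.le).trans_eq ?_
    rw [hD, ← ENNReal.rpow_mul, one_div_mul_cancel hσ.ne', ENNReal.rpow_one]
  refine (setLIntegral_mono' measurableSet_Ioi step).trans ?_
  rw [setLIntegral_Ioi_zero_mulHaar, lintegral_const_mul' _ _ ENNReal.ofReal_ne_top,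
    lintegral_mul_setLIntegral_swap hA (by fun_prop) hE, ← setLIntegral_Ioi_zero_mulHaar,
    ← lintegral_const_mul' _ _ ENNReal.ofReal_ne_top,
    ← lintegral_const_mul' _ _ ENNReal.ofReal_ne_top]
  refine setLIntegral_mono' measurableSet_Ioi fun v (hv : 0 < v) => ?_
  have hset : {t | (t, v) ∈ E} = Ioo 0 v := rfl
  -- The inner integral is `v^{bσ}/(bσ)`; multiplied by `ασ` it gives the constant `α/b`.
  rw [hset, restrict_Ioo_eq_restrict_Ioc, setLIntegral_Ioc_rpow_mulHaar hbσ hv,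
    ENNReal.mul_rpow_of_nonneg _ _ hσ.le, ofReal_rpow_rpow hv, mul_left_comm, mul_comm,
    ← ENNReal.ofReal_mul (by positivity), ← mul_assoc, ← ENNReal.ofReal_mul (by positivity)]
  refine le_of_eq ?_
  congr 2
  field_simp

/-! ### Boundedness of the Hardy-type operator. -/

theorem mellinNorm_top (E : Set ℝ) (h : ℝ → ℝ≥0∞) : mellinNorm ∞ E h = ⨆ t ∈ E, h t := if_pos rfl

/-- The hypothesis places the image below `t^{-b} M`, which is decreasing because `b ≥ 0` and so
bounds the rearrangement too. -/
theorem mellinNorm_hardyOp_top_le {α κ p b : ℝ} {q₀ : ℝ≥0∞} (hb : 0 ≤ b) {f : ℝ → ℝ≥0∞}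
    {M : ℝ≥0∞} (h : ∀ t, 0 < t → localLorentz p q₀ f (t ^ κ) ≤ ENNReal.ofReal (t ^ (α - b)) * M) :
    mellinNorm ∞ (Ioi 0) (weightedRearrangement b (hardyOp α κ p q₀ f)) ≤ M := by
  rw [mellinNorm_top]
  refine iSup₂_le fun t (ht : 0 < t) => ?_
  have h1 : rearrangement (hardyOp α κ p q₀ f) t ≤ ENNReal.ofReal (t ^ (-b)) * M := by
    refine rearrangement_le_of_antitoneOn (g := fun t => ENNReal.ofReal (t ^ (-b)) * M)
      (fun x hx y hy hxy => ?_) (fun x hx => ?_) ht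
    · dsimp only
      gcongr ENNReal.ofReal ?_ * _
      exact Real.rpow_le_rpow_of_nonpos hx hxy (by linarith)
    · calc hardyOp α κ p q₀ f x
          ≤ ENNReal.ofReal (x ^ (-α)) * (ENNReal.ofReal (x ^ (α - b)) * M) := by
            unfold hardyOp
            gcongr
            exact h x hx
        _ = _ := by
            rw [← mul_assoc, ofReal_rpow_mul hx]
            congr 3
            ring
  calc weightedRearrangement b (hardyOp α κ p q₀ f) t
      ≤ ENNReal.ofReal (t ^ b) * (ENNReal.ofReal (t ^ (-b)) * M) := by
        unfold weightedRearrangement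
        gcongr
    _ = M := by
        rw [← mul_assoc, ofReal_rpow_mul ht, add_neg_cancel, Real.rpow_zero, ENNReal.ofReal_one,
          one_mul]

/-- Boundedness of the Hardy-type operator between Lorentz spaces `L^{1/a,s₁}` and `L^{1/b,s₂}`,
away from the endpoint `a = 1/p`. -/
theorem hardyOp_bounded {α κ p a b : ℝ} {q₀ s₁ s₂ : ℝ≥0∞} (hα : 0 < α) (hκ : 0 < κ)
    (hp : 0 < p) (hq₀ : 1 ≤ q₀) (hs₁ : 1 ≤ s₁) (hs : s₁ ≤ s₂) (ha : s₁ ≠ ∞ → 0 < a)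
    (hb : 0 ≤ b) (hb' : s₂ ≠ ∞ → 0 < b) (hap : a < 1 / p) (hrel : κ * (1 / p - a) = α - b) :
    ∃ C : ℝ≥0∞, C ≠ ∞ ∧ ∀ f : ℝ → ℝ≥0∞,
      mellinNorm s₂ (Ioi 0) (weightedRearrangement b (hardyOp α κ p q₀ f)) ≤
        C * mellinNorm s₁ (Ioi 0) (weightedRearrangement a f) := by
  obtain ⟨C₁, hC₁, h₁⟩ := mellinNorm_embedding hs₁ hs ha
  obtain ⟨C₂, hC₂, h₂⟩ := localLorentz_le_lintegral hp hq₀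
  set c := 1 / p - a with hc
  have hc0 : 0 < c := by linarith
  -- The embedding `s₁ ≤ s₂` on the source side reduces to equal second exponents.
  suffices H : ∃ C : ℝ≥0∞, C ≠ ∞ ∧ ∀ f : ℝ → ℝ≥0∞,
      mellinNorm s₂ (Ioi 0) (weightedRearrangement b (hardyOp α κ p q₀ f)) ≤
        C * mellinNorm s₂ (Ioi 0) (weightedRearrangement a f) by
    obtain ⟨C, hC, h⟩ := H
    refine ⟨C * C₁, ENNReal.mul_ne_top hC hC₁, fun f => (h f).trans ?_⟩
    rw [mul_assoc]
    gcongr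
    exact h₁ f _ measurableSet_Ioi subset_rfl fun t _ => Ioc_subset_Ioi_self
  have h₂' : ∀ (f : ℝ → ℝ≥0∞) (u : ℝ), localLorentz p q₀ f u ≤
      C₂ * ∫⁻ s in Ioc 0 u, ENNReal.ofReal (s ^ c) * weightedRearrangement a f s ∂mulHaar := by
    intro f u
    refine (h₂ f u).trans_eq ?_
    congr 1
    refine setLIntegral_congr_of_subset measurableSet_Ioc Ioc_subset_Ioi_self fun t ht => ?_
    rw [← weightedRearrangement_add a c f ht, hc, sub_add_cancel]
  by_cases hs₂ : s₂ = ∞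
  · subst hs₂
    refine ⟨C₂ * ENNReal.ofReal (1 / c), ENNReal.mul_ne_top hC₂ ENNReal.ofReal_ne_top,
      fun f => mellinNorm_hardyOp_top_le hb fun t ht => ?_⟩
    have htκ : 0 < t ^ κ := Real.rpow_pos_of_pos ht κ
    set M := mellinNorm ∞ (Ioi 0) (weightedRearrangement a f) with hM
    calc localLorentz p q₀ f (t ^ κ)
        ≤ C₂ * ∫⁻ s in Ioc 0 (t ^ κ), ENNReal.ofReal (s ^ c) * M ∂mulHaar := by
          refine (h₂' f _).trans ?_
          refine mul_le_mul_right (setLIntegral_mono' measurableSet_Ioc fun s hs => ?_) _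
          gcongr
          rw [hM, mellinNorm_top]
          exact le_iSup₂_of_le s hs.1 le_rfl
      _ = _ := by
          rw [lintegral_mul_const _ (by fun_prop), setLIntegral_Ioc_rpow_mulHaar hc0 htκ,
            ← Real.rpow_mul ht.le, hrel, div_eq_mul_one_div, ENNReal.ofReal_mul (by positivity)]
          ring
  have hσ0 := toReal_pos_of_one_le (hs₁.trans hs) hs₂
  have hσ1 : 1 ≤ s₂.toReal := by
    simpa using ENNReal.toReal_mono hs₂ (hs₁.trans hs)
  set σ := s₂.toReal
  set K := ENNReal.ofReal (α / b) *
    (C₂ ^ σ * ENNReal.ofReal ((1 / c) ^ (σ - 1) * (1 / (κ * c)))) with hK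
  refine ⟨K ^ (1 / σ), ENNReal.rpow_ne_top_of_nonneg (by positivity)
    (ENNReal.mul_ne_top ENNReal.ofReal_ne_top (ENNReal.mul_ne_top
      (ENNReal.rpow_ne_top_of_nonneg hσ0.le hC₂) ENNReal.ofReal_ne_top)), fun f => ?_⟩
  rw [mellinNorm, mellinNorm, if_neg hs₂, if_neg hs₂,
    ← ENNReal.mul_rpow_of_nonneg _ _ (by positivity)]
  refine ENNReal.rpow_le_rpow ?_ (by positivity)
  refine (lintegral_weightedRearrangement_hardyOp_le hα hκ hσ0 (hb' hs₂) hq₀ f).trans ?_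
  rw [hK, mul_assoc, mul_assoc]
  gcongr
  refine le_trans ?_ (mul_le_mul_right (hardy_inequality hc0 hκ hσ1
    (measurable_weightedRearrangement a f)) _)
  rw [← lintegral_const_mul' _ _ (ENNReal.rpow_ne_top_of_nonneg hσ0.le hC₂)]
  refine setLIntegral_mono' measurableSet_Ioi fun t (ht : 0 < t) => ?_
  rw [← ENNReal.mul_rpow_of_nonneg _ _ hσ0.le]
  refine ENNReal.rpow_le_rpow ?_ hσ0.le
  rw [hardyOp, ← mul_assoc, ofReal_rpow_mul ht, mul_left_comm, hrel,
    show b + -α = -(α - b) by ring]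
  gcongr
  exact h₂' f _

/-- Boundedness of the Hardy-type operator at the endpoint, into a weak Lorentz space. -/
theorem hardyOp_bounded_endpoint {α κ p : ℝ} {q₀ s₁ : ℝ≥0∞} (hα : 0 < α) (hp : 0 < p)
    (hs₁ : 1 ≤ s₁) (hs : s₁ ≤ q₀) :
    ∃ C : ℝ≥0∞, C ≠ ∞ ∧ ∀ f : ℝ → ℝ≥0∞,
      mellinNorm ∞ (Ioi 0) (weightedRearrangement α (hardyOp α κ p q₀ f)) ≤
        C * mellinNorm s₁ (Ioi 0) (weightedRearrangement (1 / p) f) := by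
  obtain ⟨C, hC, h⟩ := mellinNorm_embedding (a := 1 / p) hs₁ hs (fun _ => by positivity)
  refine ⟨C, hC, fun f => mellinNorm_hardyOp_top_le hα.le fun t ht => ?_⟩
  rw [sub_self, Real.rpow_zero, ENNReal.ofReal_one, one_mul,
    localLorentz_eq_mellinNorm p q₀ (hs₁.trans hs)]
  exact (mellinNorm_mono_set _ Ioc_subset_Ioi_self _).trans
    (h f _ measurableSet_Ioi subset_rfl fun t _ => Ioc_subset_Ioi_self)

/-! ### Domination of the rearrangement by its average. -/

theorem weightedRearrangement_le_localLorentz {p : ℝ} (hp : 0 < p) {q₀ : ℝ≥0∞} (hq₀ : 1 ≤ q₀)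
    (f : ℝ → ℝ≥0∞) {u : ℝ} (hu : 0 < u) :
    weightedRearrangement (1 / p) f u ≤ pointwiseConst (1 / p) q₀ * localLorentz p q₀ f u := by
  rw [localLorentz_eq_mellinNorm p q₀ hq₀]
  exact weightedRearrangement_le_mellinNorm hq₀ (fun _ => by positivity) f hu subset_rfl

theorem pointwiseConst_ne_zero {a : ℝ} {s : ℝ≥0∞} (hs : 1 ≤ s) (ha : 0 < a) :
    pointwiseConst a s ≠ 0 := by
  unfold pointwiseConst
  split_ifs with h
  · simp
  · have := toReal_pos_of_one_le hs h
    exact (ENNReal.rpow_pos (ENNReal.ofReal_pos.2 (by positivity)) ENNReal.ofReal_ne_top).ne'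

/-- The averaging operator dominates the rearrangement. -/
theorem mellinNorm_le_hardyOp {p b : ℝ} (hp : 0 < p) {q₀ s : ℝ≥0∞} (hq₀ : 1 ≤ q₀) (hs : 1 ≤ s)
    (f : ℝ → ℝ≥0∞) :
    mellinNorm s (Ioi 0) (weightedRearrangement b f) ≤ pointwiseConst (1 / p) q₀ *
      mellinNorm s (Ioi 0) (weightedRearrangement b (hardyOp (1 / p) 1 p q₀ f)) := by
  rw [← mellinNorm_const_mul s hs _ (measurable_weightedRearrangement _ _)]
  refine mellinNorm_mono s measurableSet_Ioi fun t ht => ?_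
  unfold weightedRearrangement
  rw [mul_left_comm]
  gcongr
  refine rearrangement_le_mul_rearrangement (pointwiseConst_ne_zero hq₀ (by positivity))
    (pointwiseConst_ne_top _ _) (fun t ht => ?_) ht
  have h := weightedRearrangement_le_localLorentz hp hq₀ f ht
  calc rearrangement f t
      = ENNReal.ofReal (t ^ (-(1 / p))) * weightedRearrangement (1 / p) f t := by
        rw [weightedRearrangement, ← mul_assoc, ofReal_rpow_mul ht, neg_add_cancel,
          Real.rpow_zero, ENNReal.ofReal_one, one_mul]
    _ ≤ _ := by
        rw [hardyOp, Real.rpow_one, mul_left_comm]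
        gcongr

/-! ### Comparison of powers, lower bounds and test functions. -/

theorem le_of_forall_rpow_le {x y : ℝ} {C : ℝ≥0∞} (hC : C ≠ ∞)
    (h : ∀ T : ℝ, 1 ≤ T → ENNReal.ofReal (T ^ x) ≤ C * ENNReal.ofReal (T ^ y)) : x ≤ y := by
  by_contra! hlt
  have h1 : ∀ T : ℝ, 1 ≤ T → T ^ (x - y) ≤ C.toReal := by
    intro T hT
    have hT0 : 0 < T := by linarith
    have h2 := mul_le_mul_left (h T hT) (ENNReal.ofReal (T ^ (-y)))
    rw [mul_assoc, ofReal_rpow_mul hT0, ofReal_rpow_mul hT0, add_neg_cancel, Real.rpow_zero,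
      ENNReal.ofReal_one, mul_one, ← sub_eq_add_neg] at h2
    exact (ENNReal.ofReal_le_iff_le_toReal hC).1 h2
  obtain ⟨T, hT, hT1⟩ := ((tendsto_rpow_atTop (sub_pos.2 hlt)).eventually
    (Filter.eventually_gt_atTop C.toReal) |>.and (Filter.eventually_ge_atTop 1)).exists
  exact absurd (h1 T hT1) (not_le.2 hT)

theorem eq_of_forall_rpow_le {x y : ℝ} {C : ℝ≥0∞} (hC : C ≠ ∞)
    (h : ∀ T : ℝ, 0 < T → ENNReal.ofReal (T ^ x) ≤ C * ENNReal.ofReal (T ^ y)) : x = y := by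
  refine le_antisymm (le_of_forall_rpow_le hC fun T hT => h T (by linarith)) ?_
  refine neg_le_neg_iff.1 (le_of_forall_rpow_le hC fun T hT => ?_)
  have hT0 : 0 < T := by linarith
  simpa [Real.inv_rpow hT0.le, ← Real.rpow_neg hT0.le] using h T⁻¹ (inv_pos.2 hT0)

theorem le_inv_mul_of_mul_le {k : ℝ} (hk : 0 < k) {X Y : ℝ≥0∞} (h : ENNReal.ofReal k * X ≤ Y) :
    X ≤ ENNReal.ofReal k⁻¹ * Y := by
  calc X = ENNReal.ofReal k⁻¹ * (ENNReal.ofReal k * X) := by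
        rw [← mul_assoc, ← ENNReal.ofReal_mul (by positivity), inv_mul_cancel₀ hk.ne',
          ENNReal.ofReal_one, one_mul]
    _ ≤ _ := by gcongr

theorem le_mul_rearrangement_of_Ioc {f : ℝ → ℝ≥0∞} {l P : ℝ≥0∞} (hP0 : P ≠ 0) (hP : P ≠ ∞)
    {t x y : ℝ} (hx : 0 ≤ x) (hxy : x < y) (ht : t < y - x) (H : ∀ z ∈ Ioc x y, l ≤ P * f z) :
    l ≤ P * rearrangement f t := by
  have h : l / P ≤ rearrangement f t :=
    le_rearrangement_of_Ioc hx hxy ht fun z hz => ENNReal.div_le_of_le_mul' (H z hz)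
  calc l = P * (l / P) := (ENNReal.mul_div_cancel hP0 hP).symm
    _ ≤ _ := by gcongr

/-- A lower bound by a decreasing power on `(t, 3t]` passes to the rearrangement at `t`. -/
theorem le_mul_weightedRearrangement_of_Ioc {f : ℝ → ℝ≥0∞} {P : ℝ≥0∞} (hP0 : P ≠ 0) (hP : P ≠ ∞)
    {b t : ℝ} (hb : 0 ≤ b) (ht : 0 < t) {l : ℝ≥0∞}
    (H : ∀ z ∈ Ioc t (3 * t), ENNReal.ofReal (z ^ (-b)) * l ≤ P * f z) :
    l ≤ ENNReal.ofReal (3 ^ b) * P * weightedRearrangement b f t := by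
  have h : ENNReal.ofReal ((3 * t) ^ (-b)) * l ≤ P * rearrangement f t := by
    -- The interval `(t, 3t]` has length `2t`, strictly more than `t` as required.
    refine le_mul_rearrangement_of_Ioc hP0 hP ht.le (by linarith) (by linarith) fun z hz =>
      le_trans ?_ (H z hz)
    gcongr ENNReal.ofReal ?_ * _
    exact Real.rpow_le_rpow_of_nonpos (ht.trans hz.1) hz.2 (by linarith)
  have h' := le_inv_mul_of_mul_le (by positivity) h
  rw [← Real.rpow_neg (by positivity), neg_neg, Real.mul_rpow (by norm_num) ht.le,
    ENNReal.ofReal_mul (by positivity)] at h'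
  refine h'.trans_eq ?_
  rw [weightedRearrangement]
  ring

/-- The interval `(1, e^M]` has `dt/t`-measure `M`, so a function bounded below there has norm at
least of order `M^{1/s}`. This is how second exponents are detected. -/
theorem ofReal_rpow_le_mul_mellinNorm {s : ℝ≥0∞} (hs : 1 ≤ s) (hs' : s ≠ ∞) {M : ℝ} (hM : 0 ≤ M)
    {E : Set ℝ} (hE : Ioc 1 (Real.exp M) ⊆ E) {h : ℝ → ℝ≥0∞} (hh : Measurable h) {P : ℝ≥0∞}
    (H : ∀ t ∈ Ioc 1 (Real.exp M), 1 ≤ P * h t) :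
    ENNReal.ofReal (M ^ s⁻¹.toReal) ≤ P * mellinNorm s E h := by
  have hs0 := toReal_pos_of_one_le hs hs'
  calc ENNReal.ofReal (M ^ s⁻¹.toReal) = mellinNorm s (Ioc 1 (Real.exp M)) fun _ => 1 := by
        rw [mellinNorm, if_neg hs']
        simp only [ENNReal.one_rpow, setLIntegral_one]
        rw [mulHaar_Ioc one_pos (Real.one_le_exp hM), div_one, Real.log_exp,
          ENNReal.ofReal_rpow_of_nonneg hM (by positivity), ENNReal.toReal_inv, one_div]
    _ ≤ mellinNorm s (Ioc 1 (Real.exp M)) fun t => P * h t := mellinNorm_mono s measurableSet_Ioc H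
    _ = P * mellinNorm s (Ioc 1 (Real.exp M)) h := mellinNorm_const_mul s hs _ hh P
    _ ≤ _ := by gcongr; exact mellinNorm_mono_set s hE h

theorem weightedRearrangement_le_of_antitoneOn {a : ℝ} {f : ℝ → ℝ≥0∞} (hf : AntitoneOn f (Ioi 0))
    {t : ℝ} (ht : 0 < t) : weightedRearrangement a f t ≤ ENNReal.ofReal (t ^ a) * f t := by
  unfold weightedRearrangement
  gcongr
  exact rearrangement_le_of_antitoneOn hf (fun _ _ => le_rfl) ht

/-- The indicator function of `(0, X]`. -/
def initialIndicator (X : ℝ) : ℝ → ℝ≥0∞ := (Iic X).indicator fun _ => 1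

theorem measurable_initialIndicator (X : ℝ) : Measurable (initialIndicator X) :=
  measurable_const.indicator measurableSet_Iic

theorem initialIndicator_antitone (X : ℝ) : Antitone (initialIndicator X) := fun x y h => by
  unfold initialIndicator
  by_cases hy : y ≤ X
  · simp [indicator, hy, h.trans hy]
  · simp [indicator, hy]

theorem one_le_rearrangement_initialIndicator {X t : ℝ} (hX : 0 < X) (h : t < X) :
    1 ≤ rearrangement (initialIndicator X) t :=
  le_rearrangement_of_Ioc le_rfl hX (by simpa using h) fun z hz => by
    simp [initialIndicator, indicator, hz.2]

theorem mellinNorm_initialIndicator_le {a : ℝ} {s : ℝ≥0∞} (hs : 1 ≤ s) (ha : 0 ≤ a)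
    (ha' : s ≠ ∞ → 0 < a) : ∃ C : ℝ≥0∞, C ≠ ∞ ∧ ∀ X : ℝ, 0 < X →
      mellinNorm s (Ioi 0) (weightedRearrangement a (initialIndicator X)) ≤
        C * ENNReal.ofReal (X ^ a) := by
  have h0 : ∀ X t : ℝ, 0 < t → weightedRearrangement a (initialIndicator X) t ≤
      (Iic X).indicator (fun t => ENNReal.ofReal (t ^ a)) t := fun X t ht => by
    refine (weightedRearrangement_le_of_antitoneOn
      ((initialIndicator_antitone X).antitoneOn _) ht).trans_eq ?_
    by_cases h : t ≤ X <;> simp [initialIndicator, indicator, h]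
  by_cases hs' : s = ∞
  · subst hs'
    refine ⟨1, by simp, fun X hX => ?_⟩
    rw [mellinNorm_top, one_mul]
    refine iSup₂_le fun t (ht : 0 < t) => (h0 X t ht).trans ?_
    by_cases h : t ≤ X
    · rw [indicator_of_mem (show t ∈ Iic X from h)]
      exact ENNReal.ofReal_le_ofReal (Real.rpow_le_rpow ht.le h ha)
    · simp [indicator, h]
  have hs0 := toReal_pos_of_one_le hs hs'
  have has := mul_pos (ha' hs') hs0
  refine ⟨ENNReal.ofReal (1 / (a * s.toReal)) ^ (1 / s.toReal),
    ENNReal.rpow_ne_top_of_nonneg (by positivity) ENNReal.ofReal_ne_top, fun X hX => ?_⟩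
  rw [mellinNorm, if_neg hs']
  calc _ ≤ (∫⁻ t in Ioc 0 X, ENNReal.ofReal (t ^ (a * s.toReal)) ∂mulHaar) ^ (1 / s.toReal) := by
        refine ENNReal.rpow_le_rpow ?_ (by positivity)
        rw [show Ioc 0 X = Iic X ∩ Ioi 0 from inter_comm _ _,
          ← Measure.restrict_restrict measurableSet_Iic, ← lintegral_indicator measurableSet_Iic]
        refine setLIntegral_mono' measurableSet_Ioi fun t (ht : 0 < t) => ?_
        refine (ENNReal.rpow_le_rpow (h0 X t ht) hs0.le).trans_eq ?_
        by_cases h : t ≤ X <;> simp [indicator, h, ofReal_rpow_rpow ht, hs0]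
    _ = _ := by
        rw [setLIntegral_Ioc_rpow_mulHaar has hX, div_eq_mul_one_div,
          ENNReal.ofReal_mul (by positivity), ENNReal.mul_rpow_of_nonneg _ _ (by positivity),
          ofReal_rpow_rpow hX, mul_comm, mul_assoc a, mul_one_div_cancel hs0.ne', mul_one]

/-- The function equal to `1` on `(0, 1]`, to `s^{-a}` on `(1, 2X]` and to `0` beyond. -/
def truncatedPower (a X : ℝ) : ℝ → ℝ≥0∞ :=
  (Iic (2 * X)).indicator fun s => ENNReal.ofReal ((max s 1) ^ (-a))

theorem measurable_truncatedPower (a X : ℝ) : Measurable (truncatedPower a X) :=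
  Measurable.indicator (by fun_prop) measurableSet_Iic

theorem truncatedPower_antitone {a : ℝ} (ha : 0 ≤ a) (X : ℝ) : Antitone (truncatedPower a X) :=
  fun x y h => by
    unfold truncatedPower
    by_cases hy : y ≤ 2 * X
    · simp only [indicator, mem_Iic, hy, h.trans hy, if_true]
      refine ENNReal.ofReal_le_ofReal (Real.rpow_le_rpow_of_nonpos (by positivity) ?_ (by linarith))
      exact max_le_max h le_rfl
    · simp [indicator, hy]

theorem one_le_mul_weightedRearrangement_truncatedPower {a X t : ℝ} (ha : 0 ≤ a) (ht : 1 ≤ t)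
    (htX : t ≤ X) :
    1 ≤ ENNReal.ofReal (2 ^ a) * weightedRearrangement a (truncatedPower a X) t := by
  have ht0 : 0 < t := by linarith
  have h : ENNReal.ofReal ((2 * t) ^ (-a)) ≤ rearrangement (truncatedPower a X) t := by
    refine le_rearrangement_of_Ioc (x := 0) (y := 2 * t) le_rfl (by linarith) (by linarith)
      fun z hz => ?_
    refine le_trans (le_of_eq ?_) (truncatedPower_antitone ha X hz.2)
    rw [truncatedPower, indicator_of_mem (by simpa using htX), max_eq_left (by linarith)]
  calc (1 : ℝ≥0∞) = ENNReal.ofReal (2 ^ a) *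
        (ENNReal.ofReal (t ^ a) * ENNReal.ofReal ((2 * t) ^ (-a))) := by
        rw [← mul_assoc, ← ENNReal.ofReal_mul (by positivity),
          ← Real.mul_rpow (by norm_num) ht0.le, ofReal_rpow_mul (by positivity), add_neg_cancel,
          Real.rpow_zero, ENNReal.ofReal_one]
    _ ≤ _ := by
        unfold weightedRearrangement
        gcongr

/-- The weighted function is at most `t^a` on `(0, 1]`, at most `1` on `(1, 2X]` and zero beyond, so
its `s`-th power integrates to at most `1/(as) + log(2X)`. -/
theorem mellinNorm_truncatedPower_le {a : ℝ} {s : ℝ≥0∞} (hs : 1 ≤ s) (ha : 0 < a) :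
    ∃ C : ℝ≥0∞, C ≠ ∞ ∧ ∀ X : ℝ, 1 ≤ X →
      mellinNorm s (Ioi 0) (weightedRearrangement a (truncatedPower a X)) ≤
        C * ENNReal.ofReal ((1 + Real.log X) ^ s⁻¹.toReal) := by
  have h0 : ∀ X t : ℝ, 0 < t → weightedRearrangement a (truncatedPower a X) t ≤
      ENNReal.ofReal (t ^ a) * truncatedPower a X t := fun X t ht =>
    weightedRearrangement_le_of_antitoneOn ((truncatedPower_antitone ha.le X).antitoneOn _) ht
  have hle : ∀ X t : ℝ, truncatedPower a X t ≤ ENNReal.ofReal ((max t 1) ^ (-a)) := fun X t => by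
    exact indicator_le_self _ _ _
  have hle1 : ∀ X t : ℝ, 0 < t → weightedRearrangement a (truncatedPower a X) t ≤ 1 := by
    intro X t ht
    refine (h0 X t ht).trans ((mul_le_mul_right (hle X t) _).trans ?_)
    have : 0 < max t 1 := by positivity
    rw [← ENNReal.ofReal_mul (by positivity), ENNReal.ofReal_le_one, Real.rpow_neg this.le,
      ← div_eq_mul_inv, div_le_one (by positivity)]
    exact Real.rpow_le_rpow ht.le (le_max_left _ _) ha.le
  by_cases hs' : s = ∞
  · subst hs'
    refine ⟨1, by simp, fun X hX => ?_⟩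
    rw [mellinNorm_top]
    simpa using hle1 X
  have hs0 := toReal_pos_of_one_le hs hs'
  have has := mul_pos ha hs0
  set σ := s.toReal
  refine ⟨ENNReal.ofReal (1 / (a * σ) + Real.log 2 + 1) ^ (1 / σ),
    ENNReal.rpow_ne_top_of_nonneg (by positivity) ENNReal.ofReal_ne_top, fun X hX => ?_⟩
  have hlog : 0 ≤ Real.log X := Real.log_nonneg hX
  have hlog2 : 0 ≤ Real.log 2 := Real.log_nonneg (by norm_num)
  rw [mellinNorm, if_neg hs', ENNReal.toReal_inv, ← one_div, ← ENNReal.ofReal_rpow_of_pos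
    (by positivity), ← ENNReal.mul_rpow_of_nonneg _ _ (by positivity)]
  refine ENNReal.rpow_le_rpow ?_ (by positivity)
  have hpt : ∀ t ∈ Ioi (0 : ℝ), weightedRearrangement a (truncatedPower a X) t ^ σ ≤
      (Ioc 0 1).indicator (fun t => ENNReal.ofReal (t ^ (a * σ))) t +
        (Ioc 1 (2 * X)).indicator (fun _ => 1) t := by
    intro t (ht : 0 < t)
    by_cases h1 : t ≤ 1
    · rw [indicator_of_mem (s := Ioc 0 1) ⟨ht, h1⟩]
      refine le_trans ?_ le_self_add
      rw [← ofReal_rpow_rpow ht]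
      refine ENNReal.rpow_le_rpow ((h0 X t ht).trans ?_) hs0.le
      refine (mul_le_mul_right (hle X t) _).trans_eq ?_
      rw [max_eq_right h1]
      simp
    by_cases h2 : t ≤ 2 * X
    · rw [indicator_of_mem (s := Ioc 1 (2 * X)) ⟨not_le.1 h1, h2⟩]
      exact (ENNReal.rpow_le_one (hle1 X t ht) hs0.le).trans le_add_self
    · have : weightedRearrangement a (truncatedPower a X) t ≤ 0 := by
        refine (h0 X t ht).trans_eq ?_
        simp [truncatedPower, indicator, h2]
      simp [nonpos_iff_eq_zero.1 this, hs0]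
  refine (setLIntegral_mono' measurableSet_Ioi hpt).trans ?_
  rw [setLIntegral_Ioi_zero_mulHaar, lintegral_add_left
    (Measurable.indicator (by fun_prop) measurableSet_Ioc), lintegral_indicator measurableSet_Ioc,
    lintegral_indicator measurableSet_Ioc, setLIntegral_Ioc_rpow_mulHaar has one_pos,
    setLIntegral_one, mulHaar_Ioc one_pos (by linarith), div_one, Real.one_rpow,
    Real.log_mul (by norm_num) (by positivity), ← ENNReal.ofReal_add (by positivity)
    (by positivity), ← ENNReal.ofReal_mul (by positivity)]
  refine ENNReal.ofReal_le_ofReal ?_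
  have : 0 < 1 / (a * σ) := by positivity
  nlinarith

/-! ### Necessity of the conditions. -/

/-- Boundedness, with constant `C`, of `hardyOp α κ p q₀` from `L^{1/a,s₁}` to `L^{1/b,s₂}`. -/
def HardyBound (α κ p a b : ℝ) (q₀ s₁ s₂ C : ℝ≥0∞) : Prop :=
  ∀ f : ℝ → ℝ≥0∞, Measurable f → mellinNorm s₁ (Ioi 0) (weightedRearrangement a f) ≠ ∞ →
    mellinNorm s₂ (Ioi 0) (weightedRearrangement b (hardyOp α κ p q₀ f)) ≤
      C * mellinNorm s₁ (Ioi 0) (weightedRearrangement a f)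

section Necessity

variable {α κ p a b : ℝ} {q₀ s₁ s₂ C : ℝ≥0∞}

theorem HardyBound.le_mul (h : HardyBound α κ p a b q₀ s₁ s₂ C) {f : ℝ → ℝ≥0∞}
    (hf : Measurable f) {K : ℝ≥0∞} (hK : K ≠ ∞) {x : ℝ}
    (hfK : mellinNorm s₁ (Ioi 0) (weightedRearrangement a f) ≤ K * ENNReal.ofReal x) :
    mellinNorm s₂ (Ioi 0) (weightedRearrangement b (hardyOp α κ p q₀ f)) ≤
      C * K * ENNReal.ofReal x := by
  refine (h f hf (ne_top_of_le_ne_top (ENNReal.mul_ne_top hK ENNReal.ofReal_ne_top) hfK)).trans ?_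
  rw [mul_assoc]
  gcongr

theorem mul_le_mul_hardyOp (hp : 0 < p) (hq₀ : 1 ≤ q₀) (f : ℝ → ℝ≥0∞) {t : ℝ} (ht : 0 < t) :
    ENNReal.ofReal (t ^ (κ / p - α)) * rearrangement f (t ^ κ) ≤
      pointwiseConst (1 / p) q₀ * hardyOp α κ p q₀ f t := by
  have h := weightedRearrangement_le_localLorentz hp hq₀ f (Real.rpow_pos_of_pos ht κ)
  calc ENNReal.ofReal (t ^ (κ / p - α)) * rearrangement f (t ^ κ)
      = ENNReal.ofReal (t ^ (-α)) * weightedRearrangement (1 / p) f (t ^ κ) := by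
        rw [weightedRearrangement, ← Real.rpow_mul ht.le, ← mul_assoc, ofReal_rpow_mul ht]
        congr 3
        ring
    _ ≤ _ := by
        rw [hardyOp, mul_left_comm]
        gcongr

/-- The scaling relation forced by boundedness. -/
theorem HardyBound.scaling (h : HardyBound α κ p a b q₀ s₁ s₂ C) (hC : C ≠ ∞) (hκ : 0 < κ)
    (hp : 0 < p) (hq₀ : 1 ≤ q₀) (hs₁ : 1 ≤ s₁) (hs₂ : 1 ≤ s₂) (ha : 0 ≤ a)
    (ha' : s₁ ≠ ∞ → 0 < a) (hb' : s₂ ≠ ∞ → 0 < b) (he : α ≤ κ / p) :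
    κ / p - α + b = κ * a := by
  obtain ⟨K, hK, hN⟩ := mellinNorm_initialIndicator_le hs₁ ha ha'
  set P := pointwiseConst (1 / p) q₀
  have hP : P ≠ ∞ := pointwiseConst_ne_top _ _
  have hP0 : P ≠ 0 := pointwiseConst_ne_zero hq₀ (by positivity)
  set Q := pointwiseConst b s₂
  have hQ : Q ≠ ∞ := pointwiseConst_ne_top _ _
  set e := κ / p - α
  have he0 : 0 ≤ e := sub_nonneg.2 he
  -- Chosen so that `(T/4)^b (T/2)^e = k T^{e+b}`.
  set k : ℝ := (1 / 4) ^ b * (1 / 2) ^ e with hk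
  have hk0 : 0 < k := by positivity
  refine eq_of_forall_rpow_le (C := ENNReal.ofReal k⁻¹ *
    (P * (Q * (C * K * ENNReal.ofReal (2 ^ a))))) (by finiteness) fun T hT => ?_
  set f := initialIndicator (2 * T ^ κ)
  have hTκ : 0 < T ^ κ := Real.rpow_pos_of_pos hT κ
  -- On `(T/2, T]` the argument `z^κ` stays below `2 T^κ`, so `f^*(z^κ) ≥ 1`, and `e ≥ 0` gives `z^e
  -- ≥ (T/2)^e`. The interval is longer than `T/4`, which gives the bound for the rearrangement.
  have h1 : ENNReal.ofReal ((T / 2) ^ e) ≤ P * rearrangement (hardyOp α κ p q₀ f) (T / 4) := by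
    refine le_mul_rearrangement_of_Ioc hP0 hP (x := T / 2) (y := T) (by positivity)
      (by linarith) (by linarith) fun z hz => ?_
    have hz0 : 0 < z := lt_trans (by positivity) hz.1
    refine le_trans ?_ (mul_le_mul_hardyOp hp hq₀ f hz0)
    have h2 : 1 ≤ rearrangement f (z ^ κ) :=
      one_le_rearrangement_initialIndicator (by positivity)
        (lt_of_le_of_lt (Real.rpow_le_rpow hz0.le hz.2 hκ.le) (by linarith))
    calc ENNReal.ofReal ((T / 2) ^ e) ≤ ENNReal.ofReal (z ^ e) * 1 := by
          rw [mul_one]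
          exact ENNReal.ofReal_le_ofReal (Real.rpow_le_rpow (by positivity) hz.1.le he0)
      _ ≤ _ := by gcongr
  have h3 : ENNReal.ofReal ((T / 4) ^ b) * ENNReal.ofReal ((T / 2) ^ e) ≤
      P * (Q * (C * K * ENNReal.ofReal ((2 * T ^ κ) ^ a))) := by
    calc _ ≤ ENNReal.ofReal ((T / 4) ^ b) *
          (P * rearrangement (hardyOp α κ p q₀ f) (T / 4)) := by gcongr
      _ = P * weightedRearrangement b (hardyOp α κ p q₀ f) (T / 4) := by
          rw [weightedRearrangement, mul_left_comm]
      _ ≤ _ := by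
          gcongr
          refine (weightedRearrangement_le_mellinNorm hs₂ hb' _ (by positivity)
            Ioc_subset_Ioi_self).trans ?_
          gcongr
          exact h.le_mul (measurable_initialIndicator _) hK (hN _ (by positivity))
  rw [mul_assoc]
  refine le_inv_mul_of_mul_le hk0 ?_
  refine le_trans (le_of_eq ?_) (h3.trans_eq ?_)
  · rw [← ENNReal.ofReal_mul hk0.le, ← ENNReal.ofReal_mul (by positivity), hk,
      div_eq_mul_one_div T 4, div_eq_mul_one_div T 2, Real.mul_rpow hT.le (by norm_num),
      Real.mul_rpow hT.le (by norm_num), Real.rpow_add hT]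
    congr 1
    ring
  · rw [Real.mul_rpow (by norm_num) hTκ.le, ← Real.rpow_mul hT.le,
      ENNReal.ofReal_mul (by positivity)]
    ring

/-- For `z ≥ 1` the interval `(0, z^κ]` contains `(0, 1]`, so the local norm never drops below its
positive value at `1` and the image decays no faster than `t^{-α}`. -/
theorem one_le_mul_weightedRearrangement_initialIndicator (hα : 0 < α) (hκ : 0 < κ) (hp : 0 < p)
    (hq₀ : 1 ≤ q₀) {t : ℝ} (ht : 1 ≤ t) :
    1 ≤ ENNReal.ofReal (3 ^ α) * pointwiseConst (1 / p) q₀ *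
      weightedRearrangement α (hardyOp α κ p q₀ (initialIndicator 2)) t := by
  have ht0 : 0 < t := by linarith
  refine le_mul_weightedRearrangement_of_Ioc (pointwiseConst_ne_zero hq₀ (by positivity))
    (pointwiseConst_ne_top _ _) hα.le ht0 fun z hz => ?_
  have hz1 : 1 ≤ z := ht.trans hz.1.le
  have h1 := weightedRearrangement_le_localLorentz hp hq₀ (initialIndicator 2) one_pos
  have h2 : 1 ≤ weightedRearrangement (1 / p) (initialIndicator 2) 1 := by
    simpa [weightedRearrangement] using
      one_le_rearrangement_initialIndicator (X := 2) (t := 1) (by norm_num) (by norm_num)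
  have h3 := localLorentz_mono p hq₀ (initialIndicator 2) (Real.one_le_rpow hz1 hκ.le)
  rw [hardyOp, mul_left_comm]
  gcongr
  exact h2.trans (h1.trans (by gcongr))

/-- The slow decay of the image of a bounded function of bounded support. -/
theorem HardyBound.decay (h : HardyBound α κ p a b q₀ s₁ s₂ C) (hC : C ≠ ∞) (hα : 0 < α)
    (hκ : 0 < κ) (hp : 0 < p) (hq₀ : 1 ≤ q₀) (hs₁ : 1 ≤ s₁) (hs₂ : 1 ≤ s₂) (ha : 0 ≤ a)
    (ha' : s₁ ≠ ∞ → 0 < a) (hb' : s₂ ≠ ∞ → 0 < b) : b ≤ α ∧ (b = α → s₂ = ∞) := by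
  obtain ⟨K, hK, hN⟩ := mellinNorm_initialIndicator_le hs₁ ha ha'
  have hfin := h.le_mul (measurable_initialIndicator _) hK (hN 2 (by norm_num))
  set f := initialIndicator 2
  set P := ENNReal.ofReal (3 ^ α) * pointwiseConst (1 / p) q₀
  have hP : P ≠ ∞ := ENNReal.mul_ne_top ENNReal.ofReal_ne_top (pointwiseConst_ne_top _ _)
  set N := mellinNorm s₂ (Ioi 0) (weightedRearrangement b (hardyOp α κ p q₀ f))
  have hN' : N ≠ ∞ := ne_top_of_le_ne_top (by finiteness) hfin
  have key : ∀ t : ℝ, 1 ≤ t → ENNReal.ofReal (t ^ (b - α)) ≤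
      P * weightedRearrangement b (hardyOp α κ p q₀ f) t := fun t ht => by
    have ht0 : 0 < t := by linarith
    rw [show b = (b - α) + α by ring, weightedRearrangement_add _ _ _ ht0, mul_left_comm,
      add_sub_cancel_right]
    exact le_mul_of_one_le_right'
      (one_le_mul_weightedRearrangement_initialIndicator hα hκ hp hq₀ ht)
  constructor
  · refine sub_nonpos.1 (le_of_forall_rpow_le (C := P * (pointwiseConst b s₂ * N))
      (ENNReal.mul_ne_top hP (ENNReal.mul_ne_top (pointwiseConst_ne_top _ _) hN')) fun t ht => ?_)
    rw [Real.rpow_zero, ENNReal.ofReal_one, mul_one]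
    refine (key t ht).trans ?_
    gcongr
    exact weightedRearrangement_le_mellinNorm hs₂ hb' _ (by linarith) Ioc_subset_Ioi_self
  · intro hbα
    by_contra hs
    have hpos : 0 < s₂⁻¹.toReal := by
      rw [ENNReal.toReal_inv]
      exact inv_pos.2 (toReal_pos_of_one_le hs₂ hs)
    -- With `b = α` and `s₂` finite, the weighted image is bounded below on `(1, e^M]`, so its norm
    -- would grow like `M^{1/s₂}`.
    refine absurd (le_of_forall_rpow_le (x := s₂⁻¹.toReal) (y := 0) (C := P * N)
      (ENNReal.mul_ne_top hP hN') fun M hM => ?_) (not_le.2 hpos)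
    rw [Real.rpow_zero, ENNReal.ofReal_one, mul_one]
    refine ofReal_rpow_le_mul_mellinNorm hs₂ hs (by linarith) (fun t ht => one_pos.trans ht.1)
      (measurable_weightedRearrangement _ _) fun t ht => ?_
    simpa [hbα] using key t ht.1.le

theorem le_of_toReal_inv_le {s t : ℝ≥0∞} (hs : 1 ≤ s) (ht : 1 ≤ t)
    (h : s⁻¹.toReal ≤ t⁻¹.toReal) : t ≤ s := by
  have hs' : s⁻¹ ≠ ∞ := ENNReal.inv_ne_top.2 (zero_lt_one.trans_le hs).ne'
  have ht' : t⁻¹ ≠ ∞ := ENNReal.inv_ne_top.2 (zero_lt_one.trans_le ht).ne'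
  exact ENNReal.inv_le_inv.1 ((ENNReal.toReal_le_toReal hs' ht').1 h)

theorem le_of_forall_ofReal_rpow_le {s t : ℝ≥0∞} (hs : 1 ≤ s) (ht : 1 ≤ t) {D : ℝ≥0∞}
    (hD : D ≠ ∞) {k : ℝ} (hk : 0 < k) (h : ∀ M : ℝ, 1 ≤ M →
      ENNReal.ofReal (M ^ s⁻¹.toReal) ≤ D * ENNReal.ofReal ((k * M) ^ t⁻¹.toReal)) : t ≤ s := by
  refine le_of_toReal_inv_le hs ht (le_of_forall_rpow_le
    (C := D * ENNReal.ofReal (k ^ t⁻¹.toReal)) (by finiteness) fun M hM => ?_)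
  rw [mul_assoc, ← ENNReal.ofReal_mul (by positivity), ← Real.mul_rpow hk.le (by linarith)]
  exact h M hM

/-- At the endpoint `a = 1/p` the second exponent cannot exceed `q₀`. -/
theorem HardyBound.endpoint (h : HardyBound α κ p (1 / p) α q₀ s₁ ∞ C) (hC : C ≠ ∞) (hα : 0 < α)
    (hκ : 0 < κ) (hp : 0 < p) (hq₀ : 1 ≤ q₀) (hs₁ : 1 ≤ s₁) : s₁ ≤ q₀ := by
  by_cases hq : q₀ = ∞
  · simp [hq]
  have ha : 0 < 1 / p := by positivity
  obtain ⟨K, hK, hN⟩ := mellinNorm_truncatedPower_le hs₁ ha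
  refine le_of_forall_ofReal_rpow_le (D := ENNReal.ofReal (2 ^ (1 / p)) *
    (ENNReal.ofReal (3 ^ α) * 1 * (C * K))) (k := 2) hq₀ hs₁ (by finiteness) two_pos
    fun M hM => ?_
  have hX : 1 ≤ Real.exp M := Real.one_le_exp (by linarith)
  set f := truncatedPower (1 / p) (Real.exp M)
  set L := localLorentz p q₀ f (Real.exp M) with hL
  have h1 : ENNReal.ofReal (M ^ q₀⁻¹.toReal) ≤ ENNReal.ofReal (2 ^ (1 / p)) * L := by
    rw [hL, localLorentz_eq_mellinNorm p q₀ hq₀]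
    exact ofReal_rpow_le_mul_mellinNorm hq₀ hq (by linarith) (Ioc_subset_Ioc_left zero_le_one)
      (measurable_weightedRearrangement _ _) fun t ht =>
        one_le_mul_weightedRearrangement_truncatedPower ha.le ht.1.le ht.2
  -- At this point `T^κ = e^M`, so the image sees the whole logarithmic range on which `L` has size
  -- `M^{1/q₀}`.
  set T := Real.exp (M / κ)
  have hT : T ^ κ = Real.exp M := by
    rw [← Real.exp_mul, div_mul_cancel₀ _ hκ.ne']
  have hT0 : 0 < T := Real.exp_pos _
  have h2 : L ≤ ENNReal.ofReal (3 ^ α) * 1 *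
      weightedRearrangement α (hardyOp α κ p q₀ f) T := by
    refine le_mul_weightedRearrangement_of_Ioc one_ne_zero ENNReal.one_ne_top hα.le hT0
      fun z hz => ?_
    rw [one_mul, hardyOp, hL, ← hT]
    gcongr
    exact localLorentz_mono p hq₀ f (Real.rpow_le_rpow hT0.le hz.1.le hκ.le)
  have h3 : weightedRearrangement α (hardyOp α κ p q₀ f) T ≤
      C * K * ENNReal.ofReal ((2 * M) ^ s₁⁻¹.toReal) := by
    refine le_trans ?_ ((h.le_mul (measurable_truncatedPower _ _) hK (hN _ hX)).trans ?_)
    · rw [mellinNorm_top]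
      exact le_iSup₂_of_le T hT0 le_rfl
    · rw [Real.log_exp]
      gcongr
      linarith
  calc _ ≤ _ := h1
    _ ≤ ENNReal.ofReal (2 ^ (1 / p)) * (ENNReal.ofReal (3 ^ α) * 1 *
        (C * K * ENNReal.ofReal ((2 * M) ^ s₁⁻¹.toReal))) := by
        gcongr
        exact h2.trans (by gcongr)
    _ = _ := by ring

/-- Boundedness requires that the second exponents increase. -/
theorem HardyBound.exponent_le (h : HardyBound α κ p a b q₀ s₁ s₂ C) (hC : C ≠ ∞)
    (hκ : 0 < κ) (hp : 0 < p) (hq₀ : 1 ≤ q₀) (hs₁ : 1 ≤ s₁) (hs₂ : 1 ≤ s₂) (ha : 0 < a)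
    (hb : 0 ≤ b) (hrel : κ / p - α + b = κ * a) : s₁ ≤ s₂ := by
  by_cases hs : s₂ = ∞
  · simp [hs]
  obtain ⟨K, hK, hN⟩ := mellinNorm_truncatedPower_le hs₁ ha
  set P := ENNReal.ofReal (2 ^ a) * pointwiseConst (1 / p) q₀
  have hP : P ≠ ∞ := ENNReal.mul_ne_top ENNReal.ofReal_ne_top (pointwiseConst_ne_top _ _)
  have hP0 : P ≠ 0 := mul_ne_zero (ENNReal.ofReal_pos.2 (by positivity)).ne'
    (pointwiseConst_ne_zero hq₀ (by positivity))
  have hlog : 0 ≤ Real.log 3 := Real.log_nonneg (by norm_num)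
  refine le_of_forall_ofReal_rpow_le (D := ENNReal.ofReal (3 ^ b) * P * (C * K))
    (k := 1 + κ * (Real.log 3 + 1)) hs₂ hs₁ (by finiteness) (by positivity) fun M hM => ?_
  have h3M : 1 ≤ 3 * Real.exp M := by linarith [Real.one_le_exp (show 0 ≤ M by linarith)]
  -- The factor 3 leaves room for the intervals `(t, 3t]` with `t ≤ e^M`.
  set X := (3 * Real.exp M) ^ κ with hXdef
  have hX : 1 ≤ X := Real.one_le_rpow h3M hκ.le
  set f := truncatedPower a X
  have h1 : ∀ z : ℝ, 1 ≤ z → z ≤ 3 * Real.exp M →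
      ENNReal.ofReal (z ^ (-b)) ≤ P * hardyOp α κ p q₀ f z := by
    intro z hz hzM
    have hz0 : 0 < z := by linarith
    have h2 := one_le_mul_weightedRearrangement_truncatedPower (a := a) (X := X) ha.le
      (Real.one_le_rpow hz hκ.le) (Real.rpow_le_rpow hz0.le hzM hκ.le)
    calc ENNReal.ofReal (z ^ (-b)) ≤ ENNReal.ofReal (z ^ (-b)) * (ENNReal.ofReal (2 ^ a) *
          weightedRearrangement a f (z ^ κ)) := le_mul_of_one_le_right' h2
      _ = ENNReal.ofReal (2 ^ a) * (ENNReal.ofReal (z ^ (κ / p - α)) *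
          rearrangement f (z ^ κ)) := by
          rw [mul_left_comm, weightedRearrangement, ← Real.rpow_mul hz0.le, ← mul_assoc
            (ENNReal.ofReal (z ^ (-b))), ofReal_rpow_mul hz0, ← hrel]
          congr 4
          ring
      _ ≤ _ := by
          rw [mul_assoc]
          exact mul_le_mul_right (mul_le_mul_hardyOp hp hq₀ f hz0) _
  have h2 : ENNReal.ofReal (M ^ s₂⁻¹.toReal) ≤ ENNReal.ofReal (3 ^ b) * P *
      mellinNorm s₂ (Ioi 0) (weightedRearrangement b (hardyOp α κ p q₀ f)) := by
    refine ofReal_rpow_le_mul_mellinNorm hs₂ hs (by linarith) (fun t ht => one_pos.trans ht.1)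
      (measurable_weightedRearrangement _ _) fun t ht => ?_
    refine le_mul_weightedRearrangement_of_Ioc hP0 hP hb (one_pos.trans ht.1) fun z hz => ?_
    rw [mul_one]
    exact h1 z (ht.1.trans hz.1).le (hz.2.trans (by linarith [ht.2]))
  refine h2.trans ?_
  rw [mul_assoc (_ * P)]
  gcongr
  refine (h.le_mul (measurable_truncatedPower _ _) hK (hN X hX)).trans ?_
  have hlogX : 1 + Real.log X ≤ (1 + κ * (Real.log 3 + 1)) * M := by
    rw [hXdef, Real.log_rpow (by positivity), Real.log_mul (by norm_num) (Real.exp_pos _).ne',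
      Real.log_exp]
    nlinarith [mul_nonneg hκ.le hlog]
  have hlogX0 : 0 ≤ Real.log X := Real.log_nonneg hX
  gcongr

end Necessity

/-! ### Passage from extended exponents to the real reciprocals `a` and `b`. -/

theorem NormableParams.one_le_left {r s : ℝ≥0∞} (h : NormableParams r s) : 1 ≤ r := by
  rcases h with ⟨rfl, -⟩ | ⟨h, -⟩ | ⟨rfl, -⟩
  exacts [le_rfl, h.le, le_top]

theorem NormableParams.one_le_right {r s : ℝ≥0∞} (h : NormableParams r s) : 1 ≤ s := by
  rcases h with ⟨-, rfl⟩ | ⟨-, -, h⟩ | ⟨-, rfl⟩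
  exacts [le_rfl, h, le_top]

theorem toReal_inv_pos {r : ℝ≥0∞} (h : 1 ≤ r) (h' : r ≠ ∞) : 0 < r⁻¹.toReal := by
  rw [ENNReal.toReal_inv]
  exact inv_pos.2 (toReal_pos_of_one_le h h')

theorem NormableParams.toReal_inv_pos {r s : ℝ≥0∞} (h : NormableParams r s) (hs : s ≠ ∞) :
    0 < r⁻¹.toReal := by
  refine LorentzCalderon.toReal_inv_pos h.one_le_left ?_
  rcases h with ⟨rfl, -⟩ | ⟨-, h, -⟩ | ⟨-, rfl⟩
  exacts [ENNReal.one_ne_top, h.ne, absurd rfl hs]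

theorem toReal_inv_lt_one_div_iff {p : ℝ} (hp : 0 < p) {r : ℝ≥0∞} (hr : 1 ≤ r) :
    r⁻¹.toReal < 1 / p ↔ ENNReal.ofReal p < r := by
  rw [one_div, ← ENNReal.toReal_ofReal hp.le, ← ENNReal.toReal_inv,
    ENNReal.toReal_lt_toReal (ENNReal.inv_ne_top.2 (zero_lt_one.trans_le hr).ne')
      (by simpa using hp), ENNReal.inv_lt_inv, ENNReal.toReal_ofReal hp.le]

theorem toReal_inv_eq_one_div_iff {p : ℝ} (hp : 0 < p) {r : ℝ≥0∞} (hr : 1 ≤ r) :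
    r⁻¹.toReal = 1 / p ↔ r = ENNReal.ofReal p := by
  rw [one_div, ← ENNReal.toReal_ofReal hp.le, ← ENNReal.toReal_inv,
    ENNReal.toReal_eq_toReal_iff' (ENNReal.inv_ne_top.2 (zero_lt_one.trans_le hr).ne')
      (by simpa using hp), inv_inj, ENNReal.toReal_ofReal hp.le]

theorem inv_add_inv_eq_iff {q κ : ℝ} (hq : 0 < q) (hκ : 0 < κ) {r₁ r₂ : ℝ≥0∞} (h₁ : 1 ≤ r₁)
    (h₂ : 1 ≤ r₂) :
    (ENNReal.ofReal q)⁻¹ + (ENNReal.ofReal κ * r₂)⁻¹ = r₁⁻¹ ↔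
      κ / q + r₂⁻¹.toReal = κ * r₁⁻¹.toReal := by
  have hκ' : ENNReal.ofReal κ ≠ 0 := (ENNReal.ofReal_pos.2 hκ).ne'
  have e₁ : r₁⁻¹ ≠ ∞ := ENNReal.inv_ne_top.2 (zero_lt_one.trans_le h₁).ne'
  have e₂ : r₂⁻¹ ≠ ∞ := ENNReal.inv_ne_top.2 (zero_lt_one.trans_le h₂).ne'
  have eq : (ENNReal.ofReal q)⁻¹ ≠ ∞ := by simpa using hq
  have eκ : (ENNReal.ofReal κ)⁻¹ ≠ ∞ := by simpa using hκ
  rw [ENNReal.mul_inv (Or.inl hκ') (Or.inl ENNReal.ofReal_ne_top),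
    ← ENNReal.toReal_eq_toReal_iff' (by finiteness) e₁, ENNReal.toReal_add eq (by finiteness),
    ENNReal.toReal_mul, ENNReal.toReal_inv (ENNReal.ofReal q), ENNReal.toReal_inv
    (ENNReal.ofReal κ), ENNReal.toReal_ofReal hq.le, ENNReal.toReal_ofReal hκ.le]
  constructor
  · intro h
    rw [← h]
    field_simp
  · intro h
    rw [← mul_right_inj' hκ.ne', ← h]
    field_simp

theorem measurable_ereal_abs : Measurable EReal.abs :=
  EReal.measurable_of_measurable_real (by simp only [EReal.abs_def]; fun_prop)

/-! ### Part (a): the operator `R_{q₀}`. -/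

section Operator

variable {p₀ p₁ q : ℝ} {q₀ : ℝ≥0∞}

theorem rExp_pos (hp₀ : 1 < p₀) (hq : p₀ < q) (hp₁ : 1 < p₁) : 0 < rExp p₀ p₁ q :=
  div_pos (by nlinarith) (mul_pos (by linarith) (by linarith))

theorem rExp_div_sub (hp₀ : 1 < p₀) (hq : p₀ < q) (hp₁ : 1 < p₁) :
    rExp p₀ p₁ q / p₀ - 1 / p₁ = rExp p₀ p₁ q / q := by
  have h0 : p₀ ≠ 0 := by linarith
  have h1 : p₁ ≠ 0 := by linarith
  have h2 : q ≠ 0 := by linarith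
  have h3 : q - p₀ ≠ 0 := by linarith
  unfold rExp
  field_simp
  ring

theorem isBoundedOp_of_le {T : (ℝ → ℝ≥0∞) → ℝ → ℝ≥0∞} {ρ₁ ρ₂ : (ℝ → ℝ≥0∞) → ℝ≥0∞}
    (h : ∃ C : ℝ≥0∞, C ≠ ∞ ∧ ∀ f, ρ₂ (T f) ≤ C * ρ₁ f) : IsBoundedOp T ρ₁ ρ₂ := by
  obtain ⟨C, hC, h⟩ := h
  refine ⟨C.toNNReal, fun f _ _ => ?_⟩
  rw [ENNReal.coe_toNNReal hC]
  exact h f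

theorem isBoundedOp_opR_iff (hp₀ : 1 < p₀) (hq : p₀ < q) (hp₁ : 1 < p₁) (hq₀ : 1 ≤ q₀)
    {r₁ r₂ s₁ s₂ : ℝ≥0∞} (h₁ : NormableParams r₁ s₁) (h₂ : NormableParams r₂ s₂) :
    IsBoundedOp (opR p₀ p₁ q q₀) (lorentzNorm r₁ s₁) (lorentzNorm r₂ s₂) ↔
      (ENNReal.ofReal q)⁻¹ + (ENNReal.ofReal (rExp p₀ p₁ q) * r₂)⁻¹ = r₁⁻¹ ∧
      ((r₁ = ENNReal.ofReal p₀ ∧ s₁ ≤ q₀ ∧ s₂ = ∞) ∨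
        (ENNReal.ofReal p₀ < r₁ ∧ r₁ ≤ ENNReal.ofReal q ∧ 1 ≤ s₁ ∧ s₁ ≤ s₂)) := by
  have hκ := rExp_pos hp₀ hq hp₁
  have hκq := rExp_div_sub hp₀ hq hp₁
  have hop : opR p₀ p₁ q q₀ = hardyOp (1 / p₁) (rExp p₀ p₁ q) p₀ q₀ := rfl
  have hα : 0 < 1 / p₁ := by positivity
  have hp : 0 < p₀ := by linarith
  have hq0 : 0 < q := by linarith
  have hs₁ := h₁.one_le_right
  have hs₂ := h₂.one_le_right
  have ha' := h₁.toReal_inv_pos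
  have hb' := h₂.toReal_inv_pos
  have hn₁ := lorentzNorm_eq_mellinNorm r₁ s₁ hs₁
  have hn₂ := lorentzNorm_eq_mellinNorm r₂ s₂ hs₂
  rw [inv_add_inv_eq_iff hq0 hκ h₁.one_le_left h₂.one_le_left,
    ← toReal_inv_eq_one_div_iff hp h₁.one_le_left, ← toReal_inv_lt_one_div_iff hp h₁.one_le_left,
    ← not_lt (a := ENNReal.ofReal q), ← toReal_inv_lt_one_div_iff hq0 h₁.one_le_left, hop]
  have ha : 0 ≤ r₁⁻¹.toReal := ENNReal.toReal_nonneg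
  have hb : 0 ≤ r₂⁻¹.toReal := ENNReal.toReal_nonneg
  set κ := rExp p₀ p₁ q
  set a := r₁⁻¹.toReal
  set b := r₂⁻¹.toReal
  constructor
  · rintro ⟨C, hC⟩
    have h : HardyBound (1 / p₁) κ p₀ a b q₀ s₁ s₂ C := fun f hf hfin => by
      rw [← hn₁, ← hn₂]
      exact hC f hf.aemeasurable (by rw [hn₁]; exact hfin.lt_top)
    have hCt : (C : ℝ≥0∞) ≠ ∞ := ENNReal.coe_ne_top
    have hrel := h.scaling hCt hκ hp hq₀ hs₁ hs₂ ha ha' hb' (by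
      have : 0 < κ / q := by positivity
      linarith)
    obtain ⟨hbα, hdec⟩ := h.decay hCt hα hκ hp hq₀ hs₁ hs₂ ha ha' hb'
    have hκp : κ * (1 / p₀) = κ / p₀ := by ring
    have hκq' : κ * (1 / q) = κ / q := by ring
    -- From `κa = κ/q + b` and `b ≥ 0`.
    have haq : ¬ a < 1 / q := fun hlt => by
      have := mul_lt_mul_of_pos_left hlt hκ
      linarith
    refine ⟨by linarith, ?_⟩
    -- From `b ≤ α`, since `κa = κ/q + b ≤ κ/q + 1/p₁ = κ/p₀`.
    have hap : a ≤ 1 / p₀ := le_of_mul_le_mul_left (by linarith) hκ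
    rcases hap.eq_or_lt with hap | hap
    · have hb1 : b = 1 / p₁ := by rw [hap] at hrel; linarith
      have hs2 := hdec hb1
      rw [hap, hb1, hs2] at h
      exact Or.inl ⟨hap, h.endpoint hCt hα hκ hp hq₀ hs₁, hs2⟩
    · have ha0 : 0 < a := lt_of_lt_of_le (by positivity) (not_lt.1 haq)
      exact Or.inr ⟨hap, haq, hs₁, h.exponent_le hCt hκ hp hq₀ hs₁ hs₂ ha0 hb hrel⟩
  · rintro ⟨hrel, h⟩
    refine isBoundedOp_of_le ?_
    simp only [hn₁, hn₂]
    rcases h with ⟨hap, hs, hs2⟩ | ⟨hap, haq, -, hs⟩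
    · have hb1 : b = 1 / p₁ := by
        rw [hap] at hrel
        have : κ * (1 / p₀) = κ / p₀ := by ring
        linarith
      rw [hap, hb1, hs2]
      exact hardyOp_bounded_endpoint hα hp hs₁ hs
    · refine hardyOp_bounded hα hκ hp hq₀ hs₁ hs ha' hb hb' hap ?_
      have : κ * (1 / p₀ - a) = κ / p₀ - κ * a := by ring
      linarith

end Operator

/-! ### Part (b): the averaged functional. -/

theorem normEquiv_angleNorm {p : ℝ} (hp : 1 ≤ p) {q₀ r s : ℝ≥0∞} (hq₀ : 1 ≤ q₀)
    (hpr : ENNReal.ofReal p < r) (h : NormableParams r s) :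
    NormEquiv (angleNorm (lorentzNorm r s) p q₀) (lorentzNorm r s) := by
  have hp0 : 0 < p := by linarith
  have hs := h.one_le_right
  have hop : ∀ f, angleNorm (lorentzNorm r s) p q₀ f =
      lorentzNorm r s (hardyOp (1 / p) 1 p q₀ f) := fun f => by
    unfold angleNorm hardyOp
    simp only [Real.rpow_one]
  obtain ⟨C, hC, hle⟩ := hardyOp_bounded (α := 1 / p) (κ := 1) (p := p) (a := r⁻¹.toReal)
    (b := r⁻¹.toReal) (by positivity) one_pos hp0 hq₀ hs le_rfl h.toReal_inv_pos
    ENNReal.toReal_nonneg h.toReal_inv_pos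
    ((toReal_inv_lt_one_div_iff hp0 h.one_le_left).2 hpr) (by ring)
  set P := pointwiseConst (1 / p) q₀
  have hP : P ≠ ∞ := pointwiseConst_ne_top _ _
  -- The summand `1` only ensures that the constant is positive.
  refine ⟨C.toNNReal + P.toNNReal + 1, by positivity, fun f _ => ?_⟩
  rw [hop, lorentzNorm_eq_mellinNorm r s hs, lorentzNorm_eq_mellinNorm r s hs]
  push_cast
  rw [ENNReal.coe_toNNReal hC, ENNReal.coe_toNNReal hP]
  constructor
  · refine (hle f).trans ?_
    gcongr
    rw [add_assoc]
    exact le_self_add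
  · refine (mellinNorm_le_hardyOp hp0 hq₀ hs f).trans ?_
    gcongr
    exact le_add_self.trans le_self_add

theorem NormEquiv.space_eq {ρ₁ ρ₂ : (ℝ → ℝ≥0∞) → ℝ≥0∞} (h : NormEquiv ρ₁ ρ₂) :
    space ρ₁ = space ρ₂ := by
  obtain ⟨C, -, hC⟩ := h
  ext f
  refine and_congr_right fun hf => ?_
  obtain ⟨h1, h2⟩ := hC (fun t => (f t).abs) (measurable_ereal_abs.comp_aemeasurable hf)
  exact ⟨fun h => h2.trans_lt (ENNReal.mul_lt_top ENNReal.coe_lt_top h),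
    fun h => h1.trans_lt (ENNReal.mul_lt_top ENNReal.coe_lt_top h)⟩

end LorentzCalderon

end

theorem mainTheorem6 (p₀ p₁ q : ℝ) (q₀ : ℝ≥0∞) (hp₀ : 1 < p₀) (hq : p₀ < q) (hp₁ : 1 < p₁)
    (hq₀ : 1 ≤ q₀) :
    (∀ r₁ r₂ s₁ s₂ : ℝ≥0∞, NormableParams r₁ s₁ → NormableParams r₂ s₂ →
      (IsBoundedOp (opR p₀ p₁ q q₀) (lorentzNorm r₁ s₁) (lorentzNorm r₂ s₂) ↔
        (ENNReal.ofReal q)⁻¹ + (ENNReal.ofReal (rExp p₀ p₁ q) * r₂)⁻¹ = r₁⁻¹ ∧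
        ((r₁ = ENNReal.ofReal p₀ ∧ s₁ ≤ q₀ ∧ s₂ = ∞) ∨
          (ENNReal.ofReal p₀ < r₁ ∧ r₁ ≤ ENNReal.ofReal q ∧ 1 ≤ s₁ ∧ s₁ ≤ s₂)))) ∧
    (∀ (p : ℝ) (r s : ℝ≥0∞), 1 ≤ p → ENNReal.ofReal p < r → NormableParams r s →
      space (angleNorm (lorentzNorm r s) p q₀) = space (lorentzNorm r s) ∧
      NormEquiv (angleNorm (lorentzNorm r s) p q₀) (lorentzNorm r s)) := by
  refine ⟨fun r₁ r₂ s₁ s₂ h₁ h₂ => isBoundedOp_opR_iff hp₀ hq hp₁ hq₀ h₁ h₂,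
    fun p r s hp hpr h => ?_⟩
  have h' := normEquiv_angleNorm hp hq₀ hpr h
  exact ⟨h'.space_eq, h'⟩
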